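/- **Setting.** Let $G$ be an undirected graph with vertex set $\{0,\dots,n-1\}$ and positive (more generally, nonnegative) edge weights; $d_{ij}\in[0,\infty]$ is the shortest-path distance ($\infty$ if $i,j$ are not connected). For $\epsilon>0$ put $f_\epsilon(d)=\exp(-d/\epsilon)$, $f_\epsilon(\infty)=0$, and $\mathbf D^\epsilon_f=[f_\epsilon(d_{ij})]\in\mathbb R^{n\times n}$. A triple $(A,S,B)$ of pairwise disjoint sets with union $V(G)$ and with no edge between $A$ and $B$ is a *separation* with separator $S$. For $S\subseteq Y\subseteq V(G)$, $G^S[Y]$ is the subgraph induced by $Y$ in which any two distinct vertices of $S$ that are connected in $G$ are joined by an edge whose weight is their distance in $G$; its vertices are renamed $0,\dots,|Y|-1$ in increasing order. **S-GFI tree.** An S-GFI tree of $G$ is either a leaf, which stores $G$ explicitly (as a weighted adjacency matrix), or a node given by a separation $(A,S,B)$ of $G$, which stores the ids of the vertices in $A,S,B$, the distance matrices $[d_{ij}]$ for $S\times S$, $A\times S$ ($\mathbf{AD}$) and $B\times S$ ($\mathbf{BD}$), and S-GFI trees of $G^S[A\cup S]$ (left child) and $G^S[B\cup S]$ (right child).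 It is *balanced* with constant $c>0$ if $|A|,|B|\ge c\,m$ at each inner node, where $m$ is the number of vertices of the graph of that node. **Algorithm integrate**$(T,\mathbf x)$. At a leaf compute the product by brute force (shortest paths from the explicit graph, then matrix-vector multiplication). At an inner node start with $\mathbf y=0$; compute $(\mathbf L,\mathbf R)=\mathrm{cross\_compute}(\mathbf{AD},\mathbf{BD},\mathbf x_A,\mathbf x_B)$ and add $\mathbf L$ to $\mathbf y_A$ and $\mathbf R$ to $\mathbf y_B$; sort the ids of $A\cup S$ and of $B\cup S$, call integrate on the left child with $\mathbf x_{A\cup S}$ and on the right child with $\mathbf x_{B\cup S}$, and add the results to $\mathbf y_{A\cup S}$, $\mathbf y_{B\cup S}$; subtract $[f_\epsilon(d_{ij})]_{i,j\in S}\,\mathbf x_S$ from $\mathbf y_S$; return $\mathbf y$. **Algorithm cross_compute**$(\mathbf{AD},\mathbf{BD},\mathbf u,\mathbf v)$ computes $\mathbf M\mathbf v$ and $\mathbf M^\top\mathbf u$ for $\mathbf M=[f_\epsilon(\min_k(\mathbf{AD}_{ik}+\mathbf{BD}_{jk}))]_{i\in A,\,j\in B}$. For $\mathbf M\mathbf v$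 it starts with $\xi=0$ and treats each $k=1,\dots,|S|$ in turn; $\mathbf M^\top\mathbf u$ is computed in the same way with the roles exchanged. For a given $k$, rows with an infinite $k$-th entry are left out, and $w_i=(\mathbf{AD}_{ik}-\mathbf{AD}_{il})_{l\ne k}$, $z_j=(\mathbf{BD}_{jl}-\mathbf{BD}_{jk})_{l\ne k}$ are formed. To each $\xi_i$ the sum of $f_\epsilon(\mathbf{AD}_{ik}+\mathbf{BD}_{jk})v_j$ over those $j$ such that $w_i<z_j$ in the coordinates $l<k$ and $w_i\le z_j$ in the coordinates $l>k$ is added, as follows. If no coordinate remains to be compared, the sum is $e^{-\mathbf{AD}_{ik}/\epsilon}\sum_j e^{-\mathbf{BD}_{jk}/\epsilon}v_j$, where the last sum is computed once for all $i$. If one $i$ remains, the sum is computed directly. Otherwise the $w_i$ and the $z_j$ are merge-sorted by their first remaining coordinate; the $w_i$ are cut into the first half $\mathcal L^A$ (rounded up) and the rest $\mathcal R^A$; with $\mu$ the first coordinate of the last element of $\mathcal L^A$, $\mathcal R^B$ consists of the $j$ for which the first coordinate of $z_j$ is above $\mu$ ($>$ or $\ge\mu$, according to whether that coordinate is compared by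 $<$ or $\le$), and $\mathcal L^B$ of the other $j$; then the pairs $(\mathcal L^A,\mathcal L^B)$ and $(\mathcal R^A,\mathcal R^B)$ are treated recursively, and $(\mathcal L^A,\mathcal R^B)$ recursively with the first coordinate skipped. **Cost.** Running time is the number of steps in the real RAM model: arithmetic operations, comparisons and evaluations of $\exp$ on (extended) reals, and accesses to array or list cells, take unit time. **Statement.** 1. *(Exactness.)* For every $n$, every graph $G$ on $n$ vertices, every S-GFI tree $T$ of $G$, every $\epsilon>0$ and every $\mathbf x\in\mathbb R^n$, integrate$(T,\mathbf x)=\mathbf D^\epsilon_f\,\mathbf x$. 2. *(Time.)* For every $c>0$ and every polynomial $\ell$ with coefficients in $\mathbb N$ there are a constant $C$ and a polynomial $\mathrm{poly}$ with coefficients in $\mathbb N$ such that the following holds for every $n\ge2$, every graph $G$ on $n$ vertices, every $s\in\mathbb N$, every S-GFI tree $T$ of $G$ that is balanced with constant $c$, whose separators all have at most $s$ vertices and whose leaves store graphs with at most $\ell(s)$ vertices, every $\epsilon>0$ and every $\mathbf x\in\mathbb R^n$: integrate$(T,\mathbf x)$ takes at most $$C\cdot n\cdot\mathrm{poly}(s)\cdot(\log_2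 n)^{\mathrm{poly}(s)}$$ steps. -/

import Mathlib

open scoped NNReal ENNReal Matrix

noncomputable section

namespace GraphField

/-! ### Weighted graphs, shortest-path distances, separations -/

/-- An undirected weighted graph with vertex set `{0, ..., n-1}`. Only the weights of edges
matter; they are nonnegative reals (positive weights are the case of main interest). -/
structure WGraph (n : ℕ) where
  graph : SimpleGraph (Fin n)
  weight : Fin n → Fin n → ℝ≥0
  weight_symm : ∀ u v, weight u v = weight v u

namespace WGraph

variable {n : ℕ}

/-- The length of a walk: the sum of the weights of its edges. -/
def walkLength (G : WGraph n) {u v : Fin n} (p : G.graph.Walk u v) : ℝ≥0 :=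
  (p.darts.map fun d => G.weight d.fst d.snd).sum

/-- The shortest-path distance; it is `⊤` when the two vertices are not connected. -/
def dist (G : WGraph n) (u v : Fin n) : ℝ≥0∞ :=
  ⨅ p : G.graph.Walk u v, (G.walkLength p : ℝ≥0∞)

theorem walkLength_reverse (G : WGraph n) {u v : Fin n} (p : G.graph.Walk u v) :
    G.walkLength p.reverse = G.walkLength p := by
  unfold walkLength
  rw [SimpleGraph.Walk.darts_reverse, List.map_reverse, List.sum_reverse, List.map_map]
  congr 1
  apply List.map_congr_left
  intro d _
  exact G.weight_symm _ _

theorem dist_symm (G : WGraph n) (u v : Fin n) : G.dist u v = G.dist v u := by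
  apply le_antisymm
  · refine le_iInf fun p => ?_
    rw [← G.walkLength_reverse p]
    exact iInf_le _ p.reverse
  · refine le_iInf fun p => ?_
    rw [← G.walkLength_reverse p]
    exact iInf_le _ p.reverse

/-- `(A, S, B)` is a separation configuration: the three sets are pairwise disjoint, they cover
the vertex set, and there is no edge between `A` and `B`. -/
structure IsSeparation (G : WGraph n) (A S B : Finset (Fin n)) : Prop where
  disjoint_AS : Disjoint A S
  disjoint_AB : Disjoint A B
  disjoint_SB : Disjoint S B
  cover : A ∪ S ∪ B = Finset.univ
  no_edge : ∀ a ∈ A, ∀ b ∈ B, ¬ G.graph.Adj a b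

open Classical in
/-- The graph `G^S[Y]`: the subgraph induced by `Y`, in which any two different connected vertices
of `S` are joined by an edge whose weight is their distance in `G`. Its vertices are renamed
`0, ..., |Y|-1` in increasing order. -/
def torso (G : WGraph n) (S Y : Finset (Fin n)) : WGraph Y.card where
  graph :=
    { Adj := fun i j =>
        i ≠ j ∧
          if Y.orderEmbOfFin rfl i ∈ S ∧ Y.orderEmbOfFin rfl j ∈ S then
            G.dist (Y.orderEmbOfFin rfl i) (Y.orderEmbOfFin rfl j) ≠ ⊤
          else G.graph.Adj (Y.orderEmbOfFin rfl i) (Y.orderEmbOfFin rfl j)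
      symm := ⟨by
        intro i j h
        refine ⟨h.1.symm, ?_⟩
        have h2 := h.2
        split_ifs at h2 with hS
        · rw [if_pos hS.symm, G.dist_symm]
          exact h2
        · rw [if_neg fun hS' => hS hS'.symm]
          exact h2.symm⟩
      loopless := ⟨fun i h => h.1 rfl⟩ }
  weight := fun i j =>
    if Y.orderEmbOfFin rfl i ∈ S ∧ Y.orderEmbOfFin rfl j ∈ S then
      (G.dist (Y.orderEmbOfFin rfl i) (Y.orderEmbOfFin rfl j)).toNNReal
    else G.weight (Y.orderEmbOfFin rfl i) (Y.orderEmbOfFin rfl j)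
  weight_symm := by
    intro i j
    simp only [and_comm, G.dist_symm, G.weight_symm]

open Classical in
/-- An entry of the weighted adjacency matrix: `0` on the diagonal, the weight on an edge, and `⊤`
where there is no edge. -/
def adjEntry (G : WGraph n) (i j : Fin n) : ℝ≥0∞ :=
  if i = j then 0 else if G.graph.Adj i j then (G.weight i j : ℝ≥0∞) else ⊤

/-- The weighted adjacency matrix, stored row by row. -/
def adjRows (G : WGraph n) : List (List ℝ≥0∞) :=
  List.ofFn fun i => List.ofFn fun j => G.adjEntry i j

end WGraph

open Classical in
/-- `f_ε(d) = exp(-d/ε)`, with the value `exp(-∞) = 0` at infinite distance. -/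
def fEps (ε : ℝ) (d : ℝ≥0∞) : ℝ := if d = ⊤ then 0 else Real.exp (-d.toReal / ε)

/-- The generalized distance matrix `[f_ε(d(i,j))]`. -/
def WGraph.kernel {n : ℕ} (G : WGraph n) (ε : ℝ) : Matrix (Fin n) (Fin n) ℝ :=
  Matrix.of fun i j => fEps ε (G.dist i j)

/-! ### The data structure -/

/-- The raw data of a separation graph field integrator. A leaf stores an explicit graph through
its weighted adjacency matrix. An inner node stores the ids of the vertices in `A`, `S`, `B`, the
matrices of distances `S × S`, `A × S`, `B × S` (row by row), and the two children. -/
inductive SGFI : Type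
  | leaf (explicitGraph : List (List ℝ≥0∞)) : SGFI
  | node (leftIds sepIds rightIds : List ℕ)
      (sepDist leftDist rightDist : List (List ℝ≥0∞)) (left right : SGFI) : SGFI

namespace SGFI

/-- `T.Represents G`: the tree `T` is a separation graph field integrator of the graph `G`. The ids
stored at a node are the names of the vertices in the graph of that node; the ids of `A`, `S` and
`B` may be listed in any order. -/
def Represents : SGFI → ∀ {n : ℕ}, WGraph n → Prop
  | leaf W, _, G => W = G.adjRows
  | node aIds sIds bIds SD AD BD l r, n, G =>
      ∃ A S B : List (Fin n),
        A.Nodup ∧ S.Nodup ∧ B.Nodup ∧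
        G.IsSeparation A.toFinset S.toFinset B.toFinset ∧
        aIds = A.map Fin.val ∧ sIds = S.map Fin.val ∧ bIds = B.map Fin.val ∧
        (SD = S.map fun i => S.map fun j => G.dist i j) ∧
        (AD = A.map fun i => S.map fun j => G.dist i j) ∧
        (BD = B.map fun i => S.map fun j => G.dist i j) ∧
        l.Represents (G.torso S.toFinset (A.toFinset ∪ S.toFinset)) ∧
        r.Represents (G.torso S.toFinset (B.toFinset ∪ S.toFinset))

/-- Every separator of the tree is balanced with constant `c`: `|A|, |B| ≥ c m`, where `m` is the
number of vertices of the graph of the node. -/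
def Balanced (c : ℝ) : SGFI → Prop
  | leaf _ => True
  | node aIds sIds bIds _ _ _ l r =>
      c * (aIds.length + sIds.length + bIds.length : ℕ) ≤ aIds.length ∧
      c * (aIds.length + sIds.length + bIds.length : ℕ) ≤ bIds.length ∧
      l.Balanced c ∧ r.Balanced c

/-- Every separator of the tree has at most `s` vertices. -/
def SepSizeLE (s : ℕ) : SGFI → Prop
  | leaf _ => True
  | node _ sIds _ _ _ _ l r => sIds.length ≤ s ∧ l.SepSizeLE s ∧ r.SepSizeLE s

/-- Every explicit graph stored at a leaf has at most `m` vertices. -/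
def LeafSizeLE (m : ℕ) : SGFI → Prop
  | leaf W => W.length ≤ m
  | node _ _ _ _ _ _ l r => l.LeafSizeLE m ∧ r.LeafSizeLE m

end SGFI

/-! ### Counting steps

Running times are counted in the real RAM model with extended reals. One step is: one arithmetic
operation, comparison or evaluation of `exp(-d/ε)` on (extended) reals or integers, one read or
write of an array cell, or one access to or creation of a list cell. An `Array` offers access to a
cell by its address in one step; a `List` is only traversed cell by cell. In the procedures below
every recursive call is charged at least one step and, apart from what is charged, does a bounded
number of pattern matches and constructor applications. -/

/-- The result of a computation together with the number of steps it took. -/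
structure Timed (α : Type) where
  val : α
  time : ℕ

namespace Timed

/-- Sequential composition adds up the numbers of steps. -/
instance : Monad Timed where
  pure a := ⟨a, 0⟩
  bind x f := ⟨(f x.val).val, x.time + (f x.val).time⟩

/-- A primitive operation with result `a`; it takes one step. -/
def op {α : Type} (a : α) : Timed α := ⟨a, 1⟩

/-- A bulk operation (initialization or copying of an array) with `k` cells; it takes `k + 1`
steps. -/
def bulk {α : Type} (k : ℕ) (a : α) : Timed α := ⟨a, k + 1⟩

/-- The same computation, whose result carries the fact that it is the result; this is used
only to see that recursive procedures terminate. -/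
def attach {α : Type} (x : Timed α) : Timed {a : α // a = x.val} := ⟨⟨x.val, rfl⟩, x.time⟩

end Timed

open Timed

section Lists

variable {α β : Type}

/-- Length of a list. -/
def len : List α → Timed ℕ
  | [] => op 0
  | _ :: t => do
      let k ← len t
      op (k + 1)

/-- Cut a list after the first `k` entries. -/
def cut : ℕ → List α → Timed (List α × List α)
  | 0, l => op ([], l)
  | _ + 1, [] => op ([], [])
  | k + 1, x :: t => do
      let p ← cut k t
      op (x :: p.1, p.2)

/-- Cut a list of length `m` into its first `⌈m/2⌉` and its last `⌊m/2⌋` entries. -/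
def halve (l : List α) : Timed (List α × List α) := do
  let m ← len l
  let k ← op ((m + 1) / 2)
  cut k l

theorem len_val (l : List α) : (len l).val = l.length := by
  induction l with
  | nil => rfl
  | cons x t ih =>
    change (len t).val + 1 = _
    rw [ih]; rfl

theorem cut_val (k : ℕ) (l : List α) : (cut k l).val = (l.take k, l.drop k) := by
  induction k generalizing l with
  | zero => rfl
  | succ k ih =>
    cases l with
    | nil => rfl
    | cons x t =>
      change (x :: (cut k t).val.1, (cut k t).val.2) = _
      rw [ih]; rfl

theorem halve_val (l : List α) :
    (halve l).val = (l.take ((l.length + 1) / 2), l.drop ((l.length + 1) / 2)) := by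
  change (cut (((len l).val + 1) / 2) l).val = _
  rw [len_val, cut_val]

/-- Concatenation of two lists. -/
def concat : List α → List α → Timed (List α)
  | [], l => op l
  | x :: t, l => do
      let r ← concat t l
      op (x :: r)

/-- Merge two lists that are sorted by `key`. -/
def merge {κ : Type} [LinearOrder κ] (key : α → κ) : List α → List α → Timed (List α)
  | [], l => op l
  | x :: t, [] => op (x :: t)
  | x :: t, y :: u => do
      if ← op (decide (key x ≤ key y)) then
        let r ← merge key t (y :: u)
        op (x :: r)
      else
        let r ← merge key (x :: t) u
        op (y :: r)
  termination_by l₁ l₂ => l₁.length + l₂.length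

/-- Merge sort, in ascending order of `key`. -/
def msort {κ : Type} [LinearOrder κ] (key : α → κ) : List α → Timed (List α)
  | [] => op []
  | [x] => op [x]
  | x :: y :: t => do
      let ⟨p, _⟩ ← attach (halve (x :: y :: t))
      let a ← msort key p.1
      let b ← msort key p.2
      merge key a b
  termination_by l => l.length
  decreasing_by
    all_goals
      rename_i hp
      rw [hp, halve_val]
      simp
      try omega

theorem length_merge_val {κ : Type} [LinearOrder κ] (key : α → κ) (l₁ l₂ : List α) :
    (merge key l₁ l₂).val.length = l₁.length + l₂.length := by
  induction l₁, l₂ using merge.induct with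
  | case1 l => rw [merge]; simp [op]
  | case2 x t => rw [merge]; simp [op]
  | case3 x t y u ih1 ih2 =>
    rw [merge]
    by_cases h : key x ≤ key y
    · have e : decide (key x ≤ key y) = true := by simpa using h
      rw [e]
      change (x :: (merge key t (y :: u)).val).length = _
      rw [List.length_cons, ih1]; simp only [List.length_cons]; omega
    · have e : decide (key x ≤ key y) = false := by simpa using h
      rw [e]
      change (y :: (merge key (x :: t) u).val).length = _
      rw [List.length_cons, ih2]; simp only [List.length_cons]; omega

theorem length_msort_val {κ : Type} [LinearOrder κ] (key : α → κ) (l : List α) :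
    (msort key l).val.length = l.length := by
  induction hk : l.length using Nat.strong_induction_on generalizing l with
  | _ k ih =>
    match l, hk with
    | [], hk => rw [msort]; simpa [op] using hk
    | [x], hk => rw [msort]; simpa [op] using hk
    | x :: y :: t, hk =>
      rw [msort]
      change (merge key (msort key (halve (x :: y :: t)).val.1).val
        (msort key (halve (x :: y :: t)).val.2).val).val.length = _
      rw [length_merge_val, halve_val]
      simp only [List.length_cons] at hk
      rw [ih _ (by simp; omega) _ rfl, ih _ (by simp; omega) _ rfl]
      simp
      omega

/-- The list `[f x | x ∈ l]`, for a primitive operation `f`. -/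
def mapOp (f : α → β) : List α → Timed (List β)
  | [] => op []
  | x :: t => do
      let r ← mapOp f t
      let y ← op (f x)
      op (y :: r)

/-- As `mapOp`, but the entry number `k` of the list is left out. -/
def skipMapOp (f : α → β) : ℕ → List α → Timed (List β)
  | _, [] => op []
  | 0, _ :: t => do
      let r ← mapOp f t
      op r
  | k + 1, x :: t => do
      let r ← skipMapOp f k t
      let y ← op (f x)
      op (y :: r)

/-- Entry number `k` of a list of distances, found by traversing the list. -/
def nth : List ℝ≥0∞ → ℕ → Timed ℝ≥0∞
  | [], _ => op ⊤
  | x :: _, 0 => op x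
  | _ :: t, k + 1 => do
      let y ← nth t k
      op y

end Lists

/-! ### Array operations -/

/-- An array of `m` zeros. -/
def zeros (m : ℕ) : Timed (Array ℝ) := bulk m (Array.replicate m 0)

/-- The list of the values `x[i]`, for the ids `i` in a list. -/
def gather (x : Array ℝ) : List ℕ → Timed (List ℝ)
  | [] => op []
  | i :: t => do
      let r ← gather x t
      let v ← op (x.getD i 0)
      op (v :: r)

/-- Replace `y[i]` by `g (y[i]) v`, where `g` is an arithmetic operation. -/
def updateAt (g : ℝ → ℝ → ℝ) (y : Array ℝ) (i : ℕ) (v : ℝ) : Timed (Array ℝ) := do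
  let a ← op (y.getD i 0)
  let b ← op (g a v)
  op (y.setIfInBounds i b)

/-- Replace `y[i]` by `g (y[i]) v` for all pairs `(i, v)` of two lists of the same length. -/
def scatter (g : ℝ → ℝ → ℝ) (y : Array ℝ) : List ℕ → List ℝ → Timed (Array ℝ)
  | i :: t, v :: u => do
      let y₁ ← updateAt g y i v
      scatter g y₁ t u
  | _, _ => op y

/-- The number `∑ f_ε(d) x` over the entries of a list of distances and a list of values. -/
def dotF (ε : ℝ) : List ℝ≥0∞ → List ℝ → Timed ℝ
  | d :: t, x :: u => do
      let r ← dotF ε t u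
      let e ← op (fEps ε d)
      let z ← op (e * x)
      op (z + r)
  | _, _ => op 0

/-- The product of the matrix `[f_ε(d)]`, given by the rows of the matrix of the `d`, and a
vector. -/
def matVecF (ε : ℝ) : List (List ℝ≥0∞) → List ℝ → Timed (List ℝ)
  | [], _ => op []
  | row :: rows, x => do
      let r ← matVecF ε rows x
      let v ← dotF ε row x
      op (v :: r)

/-! ### The procedure `cross_compute` -/

/-- A row index `i` with the number `a_i[k]` and the vector `w_i^k`. -/
structure Query where
  idx : ℕ
  dist : ℝ
  keys : List EReal

/-- A column `j` with the numbers `b_j[k]`, `v_j` and the vector `z_j^k`. -/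
structure Point where
  dist : ℝ
  wt : ℝ
  keys : List EReal

/-- The first coordinate of the vector of a query. -/
def Query.head (q : Query) : EReal := q.keys.headD 0

/-- The first coordinate of the vector of a point. -/
def Point.head (p : Point) : EReal := p.keys.headD 0

/-- Comparison of coordinates: `w < z` in a coordinate that is compared strictly, `w ≤ z` in the
others. -/
def keyRel (strict : Bool) (w z : EReal) : Bool :=
  if strict then decide (w < z) else decide (w ≤ z)

/-- Compare two vectors in all coordinates. -/
def domin : List Bool → List EReal → List EReal → Timed Bool
  | b :: bs, w :: ws, z :: zs => do
      if ← op (keyRel b w z) then domin bs ws zs else op false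
  | _, _, _ => op true

/-- The number `∑_j exp(-b_j[k]/ε) v_j` over a list of points. -/
def sumPoints (ε : ℝ) : List Point → Timed ℝ
  | [] => op 0
  | p :: t => do
      let r ← sumPoints ε t
      let e ← op (Real.exp (-p.dist / ε))
      let z ← op (e * p.wt)
      op (z + r)

/-- Add `exp(-a_i[k]/ε) * σ` to `ξ[i]` for all queries `i` of a list. -/
def addQueries (ε σ : ℝ) : List Query → Array ℝ → Timed (Array ℝ)
  | [], ξ => op ξ
  | q :: t, ξ => do
      let e ← op (Real.exp (-q.dist / ε))
      let z ← op (e * σ)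
      let ξ₁ ← updateAt (· + ·) ξ q.idx z
      addQueries ε σ t ξ₁

/-- The points of a list whose vectors dominate that of a given query. -/
def dominating (flags : List Bool) (q : Query) : List Point → Timed (List Point)
  | [] => op []
  | p :: t => do
      let r ← dominating flags q t
      if ← domin flags q.keys p.keys then op (p :: r) else op r

/-- Divide the points into those whose first coordinate is not above the number `m` and those
whose first coordinate is above it (strictly above or at least `m`, as the coordinate requires). -/
def splitPoints (strict : Bool) (m : EReal) : List Point → Timed (List Point × List Point)
  | [] => op ([], [])
  | p :: t => do
      let r ← splitPoints strict m t
      if ← op (keyRel strict m p.head) then op (r.1, p :: r.2) else op (p :: r.1, r.2)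

/-- The first coordinate of the last query of a list. -/
def lastHead : List Query → Timed EReal
  | [] => op 0
  | [q] => op q.head
  | _ :: t => do
      let m ← lastHead t
      op m

/-- Add to `ξ[i]`, for all queries `i`, the sum of `exp(-(a_i[k]+b_j[k])/ε) v_j` over those points
`j` whose vector dominates that of `i`. The list `flags` has one entry for each coordinate that is
still to be compared and says whether it is compared strictly.

With no coordinate left the sum factorizes. With one query left the sum is computed directly.
Otherwise all vectors are sorted by the first coordinate, the queries are divided at the median of
their first coordinates into `qL`, `qR`, and the points are divided at the same number into `pL`,
`pR`. Then `qL`-`pL` and `qR`-`pR` are treated recursively, and `qL`-`pR` with the first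
coordinate skipped. -/
def crossRec (ε : ℝ) : List Bool → List Query → List Point → Array ℝ → Timed (Array ℝ)
  | _, [], _, ξ => op ξ
  | [], q :: Q, P, ξ => do
      let σ ← sumPoints ε P
      addQueries ε σ (q :: Q) ξ
  | b :: bs, [q], P, ξ => do
      let D ← dominating (b :: bs) q P
      let σ ← sumPoints ε D
      addQueries ε σ [q] ξ
  | b :: bs, q₁ :: q₂ :: Q, P, ξ => do
      let ⟨sQ, _h₁⟩ ← attach (msort Query.head (q₁ :: q₂ :: Q))
      let sP ← msort Point.head P
      let ⟨qs, _h₂⟩ ← attach (halve sQ)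
      let m ← lastHead qs.1
      let ps ← splitPoints b m sP
      let ξ₁ ← crossRec ε (b :: bs) qs.1 ps.1 ξ
      let ξ₂ ← crossRec ε (b :: bs) qs.2 ps.2 ξ₁
      let qT ← mapOp (fun q => { q with keys := q.keys.tail }) qs.1
      let pT ← mapOp (fun p => { p with keys := p.keys.tail }) ps.2
      crossRec ε bs qT pT ξ₂
  termination_by flags Q => (flags.length, Q.length)
  decreasing_by
    all_goals
      simp_wf
      first
      | (apply Prod.Lex.left; omega)
      | (apply Prod.Lex.right
         rw [_h₂, halve_val, _h₁]
         simp only [List.length_take, List.length_drop, length_msort_val, List.length_cons]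
         try omega)

/-- The queries for a given `k`; rows with `a_i[k] = ∞` are left out. -/
def mkQueries (k : ℕ) : ℕ → List (List ℝ≥0∞) → Timed (List Query)
  | _, [] => op []
  | i, row :: rows => do
      let j ← op (i + 1)
      let r ← mkQueries k j rows
      let a ← nth row k
      if ← op (decide (a = ⊤)) then op r
      else
        let w ← skipMapOp (fun x : ℝ≥0∞ => (a : EReal) - (x : EReal)) k row
        op (⟨i, a.toReal, w⟩ :: r)

/-- The points for a given `k`; rows with `b_j[k] = ∞` are left out. -/
def mkPoints (k : ℕ) : List (List ℝ≥0∞) → List ℝ → Timed (List Point)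
  | row :: rows, v :: vs => do
      let r ← mkPoints k rows vs
      let c ← nth row k
      if ← op (decide (c = ⊤)) then op r
      else
        let z ← skipMapOp (fun x : ℝ≥0∞ => (x : EReal) - (c : EReal)) k row
        op (⟨c.toReal, v, z⟩ :: r)
  | _, _ => op []

/-- Coordinates that belong to indices below `k` are compared strictly, those that belong to
indices above `k` (and below `s`) are not: among several indices at which a minimum is attained
the least one counts. -/
def mkFlags (k s : ℕ) : Timed (List Bool) :=
  bulk s (List.replicate k true ++ List.replicate (s - 1 - k) false)

/-- Treat the indices `0, ..., k-1` of the separator (of size `s`) one after another. -/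
def crossLoop (ε : ℝ) (s : ℕ) (AD BD : List (List ℝ≥0∞)) (v : List ℝ) :
    ℕ → Array ℝ → Timed (Array ℝ)
  | 0, ξ => op ξ
  | k + 1, ξ => do
      let ξ₁ ← crossLoop ε s AD BD v k ξ
      let Q ← mkQueries k 0 AD
      let P ← mkPoints k BD v
      let flags ← mkFlags k s
      crossRec ε flags Q P ξ₁

/-- The product with `v` of the matrix of the `f_ε(min_k (AD[i][k] + BD[j][k]))`. -/
def crossHalf (ε : ℝ) (s : ℕ) (AD BD : List (List ℝ≥0∞)) (v : List ℝ) : Timed (List ℝ) := do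
  let m ← len AD
  let ξ ← zeros m
  let ξ₁ ← crossLoop ε s AD BD v s ξ
  bulk m ξ₁.toList

/-- The products of the matrix of the `f_ε(min_k (AD[i][k] + BD[j][k]))` with `v` and of its
transpose with `u`. -/
def crossCompute (ε : ℝ) (s : ℕ) (AD BD : List (List ℝ≥0∞)) (u v : List ℝ) :
    Timed (List ℝ × List ℝ) := do
  let L ← crossHalf ε s AD BD v
  let R ← crossHalf ε s BD AD u
  op (L, R)

/-! ### Brute force at the leaves -/

/-- The minimum of the sums of corresponding entries of two lists. -/
def minPlus : List ℝ≥0∞ → List ℝ≥0∞ → Timed ℝ≥0∞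
  | x :: t, y :: u => do
      let r ← minPlus t u
      let z ← op (x + y)
      op (min z r)
  | _, _ => op ⊤

/-- One round of relaxation of a list of distances from one vertex; the second argument runs
through the rows of the (symmetric) weighted adjacency matrix. -/
def relax (d : List ℝ≥0∞) : List (List ℝ≥0∞) → Timed (List ℝ≥0∞)
  | [] => op []
  | row :: rows => do
      let r ← relax d rows
      let z ← minPlus d row
      op (z :: r)

/-- `k` rounds of relaxation. -/
def relaxRounds (W : List (List ℝ≥0∞)) : ℕ → List ℝ≥0∞ → Timed (List ℝ≥0∞)
  | 0, d => op d
  | k + 1, d => do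
      let d₁ ← relax d W
      relaxRounds W k d₁

/-- The distances from all the vertices whose rows are in the last argument. -/
def allDist (W : List (List ℝ≥0∞)) (k : ℕ) : List (List ℝ≥0∞) → Timed (List (List ℝ≥0∞))
  | [] => op []
  | row :: rows => do
      let r ← allDist W k rows
      let d ← relaxRounds W k row
      op (d :: r)

/-- The product of the matrix `[f_ε(d(i,j))]` of an explicit graph and a vector. -/
def bruteForce (ε : ℝ) (W : List (List ℝ≥0∞)) (x : Array ℝ) : Timed (Array ℝ) := do
  let m ← len W
  let D ← allDist W m W
  let xs ← bulk x.size x.toList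
  let ys ← matVecF ε D xs
  bulk m ys.toArray

/-! ### The procedure `integrate` -/

/-- The recursive call on a child whose vertices are the elements of the two lists of ids; the
result is added to `y` at these ids. -/
def callChild (child : Array ℝ → Timed (Array ℝ)) (x y : Array ℝ) (ids sIds : List ℕ) :
    Timed (Array ℝ) := do
  let c ← concat ids sIds
  let sorted ← msort id c
  let xc ← gather x sorted
  let m ← len xc
  let xc ← bulk m xc.toArray
  let yc ← child xc
  let yc ← bulk m yc.toList
  scatter (· + ·) y sorted yc

/-- The procedure `integrate` for `f_ε(d) = exp(-d/ε)`. -/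
def SGFI.integrate (ε : ℝ) : SGFI → Array ℝ → Timed (Array ℝ)
  | .leaf W, x => bruteForce ε W x
  | .node aIds sIds bIds SD AD BD l r, x => do
      let y ← zeros x.size
      let xA ← gather x aIds
      let xB ← gather x bIds
      let s ← len sIds
      let LR ← crossCompute ε s AD BD xA xB
      let y ← scatter (· + ·) y aIds LR.1
      let y ← scatter (· + ·) y bIds LR.2
      let y ← callChild (l.integrate ε) x y aIds sIds
      let y ← callChild (r.integrate ε) x y bIds sIds
      let xS ← gather x sIds
      let SY ← matVecF ε SD xS
      scatter (· - ·) y sIds SY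

end GraphField

end

noncomputable section

namespace GraphField

open Timed

/-! ### Values and step counts of the basic combinators -/

namespace Timed

variable {α β : Type}

/-! Exactness is inclusion–exclusion over the blocks of the kernel matrix. Every walk between `A`
and `B` meets `S`, so a distance between `u ∈ A` and `v ∈ B` is the minimum over `k ∈ S` of `d(u,k)
+ d(v,k)` (`WGraph.IsSeparation.iInf_dist`); hence the `A × B` and `B × A` blocks are what
`crossCompute` multiplies by. In the graph of a child any excursion out of the vertex set can be
replaced by an edge inside `S`, so distances there agree with those of the whole graph
(`WGraph.torso_dist`), and the two recursive calls supply the blocks on `A ∪ S` and `B ∪ S`. Only `S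
× S` is counted twice, and it is subtracted once (`integrate_val`).

Inside `crossCompute`, the exponential turns the sum `a_k + b_k` into a product, so for a fixed `k`
the contribution factorizes once the right pairs are selected. A pair is assigned to the least index
`k` attaining its minimum (`sum_indexTerm`). For finite `a_k`, `b_k` this condition says that the
difference vector of the row lies below that of the column, strictly in the coordinates before `k`
and weakly in those after it. The resulting dominance sums are computed by divide and conquer on one
coordinate: pairs on the same side of the median are treated recursively, pairs with the row below
and the column above lose that coordinate, and the remaining pairs contribute nothing
(`crossSum_split`, `crossRec_val`). With `d` coordinates and at most `2 ^ h` rows the recursion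
costs about `(d+1) (h+2)^d` sorting passes (`crossRec_recurrence`, `crossRec_time_of_ne_nil`).

Thus a node with `n` vertices costs `n Q` steps, apart from its children, with `Q = unitCost`
(`integrate_node_time`). Balance makes the depth logarithmic, but the children have up to `n + s`
vertices together, and the copies of the separator must be paid for. Subgraphs with at most `D s`
vertices have depth `O(log s)`, so a bound exponential in the depth is still polynomial in `s`
(`SGFI.time_le_four_pow`). Larger graphs use the potential `n - s`, which does not increase in total
when a graph is split: `(n₁ - s) + (n₂ - s) ≤ n - s`. This gives a bound linear in the depth
(`SGFI.time_add_le`).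

It remains to write powers of `⌈log₂ n⌉ + 2` as powers of `log₂ n` (`clog_pow_le`). Constants to the
power `s` are absorbed by enlarging the exponent when `log₂ n ≥ 2`. For `n < 4` this is impossible,
but there separators have at most `n` vertices, so the exponent is bounded. -/

@[simp] theorem val_bind (x : Timed α) (f : α → Timed β) : (x >>= f).val = (f x.val).val := rfl
@[simp] theorem time_bind (x : Timed α) (f : α → Timed β) :
    (x >>= f).time = x.time + (f x.val).time := rfl
@[simp] theorem val_op (a : α) : (op a).val = a := rfl
@[simp] theorem time_op (a : α) : (op a).time = 1 := rfl
@[simp] theorem val_bulk (k : ℕ) (a : α) : (bulk k a).val = a := rfl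
@[simp] theorem time_bulk (k : ℕ) (a : α) : (bulk k a).time = k + 1 := rfl

end Timed

/-! ### Lists and merge sort -/

section Lists

variable {α β : Type}

theorem len_time (l : List α) : (len l).time = l.length + 1 := by
  induction l with
  | nil => rfl
  | cons x t ih => simp [len, ih]

theorem cut_time (k : ℕ) (l : List α) : (cut k l).time ≤ l.length + 1 := by
  induction k generalizing l with
  | zero => simp [cut]
  | succ k ih =>
    cases l with
    | nil => simp [cut]
    | cons x t => simpa [cut] using ih t

theorem halve_time (l : List α) : (halve l).time ≤ 2 * l.length + 3 := by
  have := cut_time ((l.length + 1) / 2) l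
  simp only [halve, time_bind, val_op, time_op, len_time, len_val]
  omega

theorem concat_val (l₁ l₂ : List α) : (concat l₁ l₂).val = l₁ ++ l₂ := by
  induction l₁ with
  | nil => rfl
  | cons x t ih => simp [concat, ih]

theorem concat_time (l₁ l₂ : List α) : (concat l₁ l₂).time = l₁.length + 1 := by
  induction l₁ with
  | nil => rfl
  | cons x t ih => simp [concat, ih]

section Sorting

variable {κ : Type} [LinearOrder κ] (key : α → κ)

theorem merge_time (l₁ l₂ : List α) :
    (merge key l₁ l₂).time ≤ 2 * (l₁.length + l₂.length) + 1 := by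
  induction l₁, l₂ using merge.induct with
  | case1 l => rw [merge]; simp
  | case2 x t => rw [merge]; simp
  | case3 x t y u ih1 ih2 =>
    rw [merge]
    by_cases h : key x ≤ key y
    · simp only [h, time_bind, val_op, time_op, decide_true, if_true, List.length_cons] at ih1 ⊢
      omega
    · simp only [h, time_bind, val_op, time_op, decide_false, if_false, List.length_cons,
        Bool.false_eq_true] at ih2 ⊢
      omega

theorem merge_perm (l₁ l₂ : List α) : (merge key l₁ l₂).val.Perm (l₁ ++ l₂) := by
  induction l₁, l₂ using merge.induct with
  | case1 l => rw [merge]; simp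
  | case2 x t => rw [merge]; simp
  | case3 x t y u ih1 ih2 =>
    rw [merge]
    by_cases h : key x ≤ key y
    · simpa [h] using ih1
    · simpa [h] using (ih2.cons y).trans (List.perm_middle (l₁ := x :: t)).symm

theorem merge_sorted (l₁ l₂ : List α) (h₁ : l₁.Pairwise fun a b => key a ≤ key b)
    (h₂ : l₂.Pairwise fun a b => key a ≤ key b) :
    (merge key l₁ l₂).val.Pairwise fun a b => key a ≤ key b := by
  induction l₁, l₂ using merge.induct with
  | case1 l => rw [merge]; simpa
  | case2 x t => rw [merge]; simpa using h₁
  | case3 x t y u ih1 ih2 =>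
    rw [merge]
    rw [List.pairwise_cons] at h₁ h₂
    by_cases h : key x ≤ key y
    · simp only [h, val_bind, val_op, decide_true, if_true, List.pairwise_cons]
      refine ⟨fun z hz => ?_, ih1 h₁.2 (List.pairwise_cons.2 h₂)⟩
      rw [(merge_perm key _ _).mem_iff, List.mem_append, List.mem_cons] at hz
      rcases hz with hz | rfl | hz
      · exact h₁.1 z hz
      · exact h
      · exact h.trans (h₂.1 z hz)
    · simp only [h, val_bind, val_op, decide_false, if_false, List.pairwise_cons,
        Bool.false_eq_true]
      refine ⟨fun z hz => ?_, ih2 (List.pairwise_cons.2 h₁) h₂.2⟩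
      have h' := (not_le.1 h).le
      rw [(merge_perm key _ _).mem_iff, List.mem_append, List.mem_cons] at hz
      rcases hz with (rfl | hz) | hz
      · exact h'
      · exact h'.trans (h₁.1 z hz)
      · exact h₂.1 z hz

/-- The recursion equation without `attach`, which serves only termination and costs no steps;
`crossRec_cons_cons` has the same purpose. -/
theorem msort_cons_cons (x y : α) (t : List α) :
    msort key (x :: y :: t) = (do
      let p ← halve (x :: y :: t)
      let a ← msort key p.1
      let b ← msort key p.2
      merge key a b) := by
  rw [msort]; rfl

theorem msort_perm_sorted (l : List α) :
    (msort key l).val.Perm l ∧ (msort key l).val.Pairwise fun a b => key a ≤ key b := by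
  induction hk : l.length using Nat.strong_induction_on generalizing l with
  | _ k ih =>
    match l, hk with
    | [], hk => rw [msort]; simp
    | [x], hk => rw [msort]; simp
    | x :: y :: t, hk =>
      simp only [List.length_cons] at hk
      rw [msort_cons_cons]
      simp only [val_bind, halve_val]
      have h1 := ih _ (by simp; omega) ((x :: y :: t).take (((x :: y :: t).length + 1) / 2)) rfl
      have h2 := ih _ (by simp; omega) ((x :: y :: t).drop (((x :: y :: t).length + 1) / 2)) rfl
      refine ⟨(merge_perm key _ _).trans ?_, merge_sorted key _ _ h1.2 h2.2⟩
      refine (h1.1.append h2.1).trans ?_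
      rw [List.take_append_drop]

theorem msort_perm (l : List α) : (msort key l).val.Perm l := (msort_perm_sorted key l).1

theorem msort_sorted (l : List α) : (msort key l).val.Pairwise fun a b => key a ≤ key b :=
  (msort_perm_sorted key l).2

/-- Halving and merging `m ≥ 2` entries takes at most `4m + 4 ≤ 6m` steps on each of the `h` levels.
Excluding the empty list avoids an additive constant, which would accumulate in the recursion; both
halves of a list with at least two entries are nonempty. -/
theorem msort_time_of_ne_nil (h : ℕ) (l : List α) (hl : l ≠ []) (hh : l.length ≤ 2 ^ h) :
    (msort key l).time ≤ (6 * h + 1) * l.length := by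
  induction h generalizing l with
  | zero =>
    match l, hl, hh with
    | [x], _, _ => rw [msort]; simp
    | x :: y :: t, _, hh => simp at hh
  | succ h ih =>
    match l, hl, hh with
    | [x], _, _ => rw [msort]; simp
    | x :: y :: t, _, hh =>
      rw [msort_cons_cons]
      simp only [time_bind, halve_val]
      set l := x :: y :: t with hl
      have hm : 2 ≤ l.length := by simp [hl]
      set k := (l.length + 1) / 2 with hk
      have e1 : (l.take k).length = k := by rw [List.length_take]; omega
      have e2 : (l.drop k).length = l.length - k := by rw [List.length_drop]
      have hp : 2 ^ (h + 1) = 2 * 2 ^ h := by ring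
      have h1 := ih (l.take k) (List.ne_nil_of_length_pos (by omega)) (by omega)
      have h2 := ih (l.drop k) (List.ne_nil_of_length_pos (by omega)) (by omega)
      have h3 := merge_time key (msort key (l.take k)).val (msort key (l.drop k)).val
      have h4 := halve_time l
      rw [length_msort_val, length_msort_val] at h3
      have e3 : (l.take k).length + (l.drop k).length = l.length := by omega
      have h5 : (6 * h + 1) * (l.take k).length + (6 * h + 1) * (l.drop k).length
          = (6 * h + 1) * l.length := by rw [← e3]; ring
      have h6 : (6 * (h + 1) + 1) * l.length = (6 * h + 1) * l.length + 6 * l.length := by ring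
      omega

theorem msort_time (h : ℕ) (l : List α) (hh : l.length ≤ 2 ^ h) :
    (msort key l).time ≤ (6 * h + 1) * l.length + 1 := by
  rcases eq_or_ne l [] with rfl | hl
  · rw [msort]; simp
  · exact (msort_time_of_ne_nil key h l hl hh).trans (Nat.le_succ _)

end Sorting

theorem mapOp_val (f : α → β) (l : List α) : (mapOp f l).val = l.map f := by
  induction l with
  | nil => rfl
  | cons x t ih => simp [mapOp, ih]

theorem mapOp_time (f : α → β) (l : List α) : (mapOp f l).time = 2 * l.length + 1 := by
  induction l with
  | nil => rfl
  | cons x t ih => simp [mapOp, ih]; ring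

theorem skipMapOp_time (f : α → β) (k : ℕ) (l : List α) :
    (skipMapOp f k l).time ≤ 2 * l.length + 1 := by
  induction l generalizing k with
  | nil => simp [skipMapOp]
  | cons x t ih =>
    cases k with
    | zero => simp [skipMapOp, mapOp_time]
    | succ k => have := ih k; simp [skipMapOp]; omega

theorem skipMapOp_val (f : α → β) (k : ℕ) (l : List α) :
    (skipMapOp f k l).val = (l.eraseIdx k).map f := by
  induction l generalizing k with
  | nil => simp [skipMapOp]
  | cons x t ih =>
    cases k with
    | zero => simp [skipMapOp, mapOp_val]
    | succ k => simp [skipMapOp, ih]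

theorem nth_val (l : List ℝ≥0∞) (k : ℕ) : (nth l k).val = l.getD k ⊤ := by
  induction l generalizing k with
  | nil => rfl
  | cons x t ih =>
    cases k with
    | zero => rfl
    | succ k => simpa [nth] using ih k

theorem nth_time (l : List ℝ≥0∞) (k : ℕ) : (nth l k).time ≤ l.length + 1 := by
  induction l generalizing k with
  | nil => simp [nth]
  | cons x t ih =>
    cases k with
    | zero => simp [nth]
    | succ k => simpa [nth] using ih k

end Lists

/-! ### Arrays as functions on `Fin n`, and matrix-vector products -/

theorem gather_val (x : Array ℝ) (l : List ℕ) :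
    (gather x l).val = l.map fun i => x.getD i 0 := by
  induction l with
  | nil => rfl
  | cons i t ih => simp [gather, ih]

theorem gather_time (x : Array ℝ) (l : List ℕ) : (gather x l).time = 2 * l.length + 1 := by
  induction l with
  | nil => rfl
  | cons i t ih => simp [gather, ih]; ring

theorem updateAt_time (g : ℝ → ℝ → ℝ) (y : Array ℝ) (i : ℕ) (v : ℝ) :
    (updateAt g y i v).time = 3 := rfl

theorem updateAt_val_size (g : ℝ → ℝ → ℝ) (y : Array ℝ) (i : ℕ) (v : ℝ) :
    (updateAt g y i v).val.size = y.size := by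
  simp [updateAt]

theorem updateAt_val_getD (g : ℝ → ℝ → ℝ) (y : Array ℝ) (i : ℕ) (v : ℝ) (hi : i < y.size)
    (j : ℕ) :
    (updateAt g y i v).val.getD j 0 = if i = j then g (y.getD i 0) v else y.getD j 0 := by
  simp only [updateAt, val_bind, val_op]
  rw [Array.getD_eq_getD_getElem?, Array.getElem?_setIfInBounds]
  split_ifs with h
  · simp
  · simp

theorem getD_ofFn {n : ℕ} (y : Fin n → ℝ) (i : Fin n) : (Array.ofFn y).getD i 0 = y i := by
  simp [Array.getD]

theorem array_eq_ofFn {n : ℕ} (a : Array ℝ) (y : Fin n → ℝ) (ha : a.size = n)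
    (h : ∀ i : Fin n, a.getD i 0 = y i) : a = Array.ofFn y := by
  apply Array.ext
  · simp [ha]
  · intro i h1 h2
    have := h ⟨i, ha ▸ h1⟩
    simp only [Array.getElem_ofFn]
    rw [← this]
    simp [Array.getD, h1]

theorem updateAt_ofFn (g : ℝ → ℝ → ℝ) {n : ℕ} (y : Fin n → ℝ) (i : Fin n) (v : ℝ) :
    (updateAt g (Array.ofFn y) i v).val = Array.ofFn (Function.update y i (g (y i) v)) := by
  apply array_eq_ofFn
  · simp [updateAt_val_size]
  · intro j
    rw [updateAt_val_getD _ _ _ _ (by simp), getD_ofFn, getD_ofFn, Function.update_apply]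
    simp [Fin.ext_iff, eq_comm]

theorem scatter_time (g : ℝ → ℝ → ℝ) (y : Array ℝ) (l : List ℕ) (v : List ℝ) :
    (scatter g y l v).time ≤ 3 * l.length + 1 := by
  induction l generalizing y v with
  | nil => simp [scatter]
  | cons i t ih =>
    cases v with
    | nil => simp [scatter]
    | cons a u =>
      have := ih (updateAt g y i a).val u
      simp only [scatter, time_bind, updateAt_time, List.length_cons]
      omega

/-- Since the target cells are distinct, every cell is updated at most once and its old value is
still the one in `y`. Describing the result by a function `z` lets each use name the next state of
the array. -/
theorem scatter_ofFn (g : ℝ → ℝ → ℝ) {n : ℕ} {ι : Type} (y : Fin n → ℝ) (l : List ι)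
    (e : ι → Fin n) (f : ι → ℝ) (z : Fin n → ℝ) (hl : (l.map e).Nodup)
    (hz : ∀ i ∈ l, z (e i) = g (y (e i)) (f i)) (hz' : ∀ j, j ∉ l.map e → z j = y j) :
    (scatter g (Array.ofFn y) (l.map fun i => (e i : ℕ)) (l.map f)).val = Array.ofFn z := by
  induction l generalizing y with
  | nil =>
    simp only [List.map_nil, scatter, val_op]
    congr 1
    exact funext fun j => (hz' j (by simp)).symm
  | cons i t ih =>
    simp only [List.map_cons, List.nodup_cons] at hl
    simp only [List.map_cons, scatter, val_bind, updateAt_ofFn]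
    apply ih _ hl.2
    · intro j hj
      rw [Function.update_of_ne, hz j (by simp [hj])]
      rintro h
      exact hl.1 (h ▸ List.mem_map_of_mem hj)
    · intro j hj
      rcases eq_or_ne j (e i) with rfl | h
      · simp [hz i]
      · rw [Function.update_of_ne h]
        exact hz' j (by simp only [List.map_cons, List.mem_cons, not_or]; exact ⟨h, hj⟩)

theorem dotF_time (ε : ℝ) (l : List ℝ≥0∞) (x : List ℝ) : (dotF ε l x).time ≤ 3 * x.length + 1 := by
  induction l generalizing x with
  | nil => simp [dotF]
  | cons d t ih =>
    cases x with
    | nil => simp [dotF]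
    | cons a u => have := ih u; simp [dotF]; omega

theorem dotF_map {ι : Type} (ε : ℝ) (l : List ι) (d : ι → ℝ≥0∞) (x : ι → ℝ) :
    (dotF ε (l.map d) (l.map x)).val = (l.map fun j => fEps ε (d j) * x j).sum := by
  induction l with
  | nil => rfl
  | cons i t ih => simp [dotF, ih]

theorem matVecF_time (ε : ℝ) (M : List (List ℝ≥0∞)) (x : List ℝ) :
    (matVecF ε M x).time ≤ (3 * x.length + 2) * M.length + 1 := by
  induction M with
  | nil => simp [matVecF]
  | cons row rows ih =>
    have := dotF_time ε row x
    simp only [matVecF, time_bind, time_op, List.length_cons, mul_add, mul_one]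
    omega

theorem matVecF_map {ι κ : Type} (ε : ℝ) (k : List κ) (l : List ι) (d : κ → ι → ℝ≥0∞)
    (x : ι → ℝ) :
    (matVecF ε (k.map fun i => l.map (d i)) (l.map x)).val =
      k.map fun i => (l.map fun j => fEps ε (d i j) * x j).sum := by
  induction k with
  | nil => rfl
  | cons i t ih => simp [matVecF, ih, dotF_map]

/-! ### Dominance sums and correctness of `crossRec` -/

/-- Whether the first vector is below the second one in all coordinates. -/
def below (flags : List Bool) (w z : List EReal) : Bool := (domin flags w z).val

theorem below_nil (w z : List EReal) : below [] w z = true := by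
  simp [below, domin]

/-- The length hypotheses matter: `domin` returns `true` as soon as one list runs out, whereas
`headD` would go on comparing a default value. -/
theorem below_cons (b : Bool) (bs : List Bool) (w z : List EReal) (hw : w.length = bs.length + 1)
    (hz : z.length = bs.length + 1) :
    below (b :: bs) w z = (keyRel b (w.headD 0) (z.headD 0) && below bs w.tail z.tail) := by
  match w, z, hw, hz with
  | x :: w, y :: z, _, _ =>
    simp only [below, domin, val_bind, val_op, List.headD_cons, List.tail_cons]
    cases keyRel b x y <;> simp

theorem domin_time (flags : List Bool) (w z : List EReal) :
    (domin flags w z).time ≤ flags.length + 1 := by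
  induction flags generalizing w z with
  | nil => simp [domin]
  | cons b bs ih =>
    match w, z with
    | [], z => simp [domin]
    | x :: w, [] => simp [domin]
    | x :: w, y :: z =>
      have := ih w z
      simp only [domin, time_bind, val_op, time_op, List.length_cons]
      cases keyRel b x y
      · simp
      · simp only [if_true]
        omega

theorem sumPoints_val (ε : ℝ) (P : List Point) :
    (sumPoints ε P).val = (P.map fun p => Real.exp (-p.dist / ε) * p.wt).sum := by
  induction P with
  | nil => rfl
  | cons p t ih => simp [sumPoints, ih]

theorem sumPoints_time (ε : ℝ) (P : List Point) : (sumPoints ε P).time = 3 * P.length + 1 := by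
  induction P with
  | nil => rfl
  | cons p t ih => simp [sumPoints, ih]; ring

theorem addQueries_time (ε σ : ℝ) (Q : List Query) (ξ : Array ℝ) :
    (addQueries ε σ Q ξ).time = 5 * Q.length + 1 := by
  induction Q generalizing ξ with
  | nil => rfl
  | cons q t ih => simp [addQueries, ih, updateAt_time]; ring

theorem addQueries_val_size (ε σ : ℝ) (Q : List Query) (ξ : Array ℝ) :
    (addQueries ε σ Q ξ).val.size = ξ.size := by
  induction Q generalizing ξ with
  | nil => rfl
  | cons q t ih => simp [addQueries, ih, updateAt_val_size]

theorem addQueries_val_getD (ε σ : ℝ) (Q : List Query) (ξ : Array ℝ)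
    (hQ : ∀ q ∈ Q, q.idx < ξ.size) (i : ℕ) :
    (addQueries ε σ Q ξ).val.getD i 0 = ξ.getD i 0 +
      (Q.map fun q => if q.idx = i then Real.exp (-q.dist / ε) * σ else 0).sum := by
  induction Q generalizing ξ with
  | nil => simp [addQueries]
  | cons q t ih =>
    simp only [addQueries, val_bind, val_op, List.map_cons, List.sum_cons]
    rw [ih _ (by simpa [updateAt_val_size] using fun p hp => hQ p (List.mem_cons_of_mem _ hp)),
      updateAt_val_getD _ _ _ _ (hQ q List.mem_cons_self)]
    split_ifs with h
    · subst h; ring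
    · ring

theorem sum_map_filter {α : Type} (l : List α) (c : α → Bool) (f : α → ℝ) :
    ((l.filter c).map f).sum = (l.map fun x => if c x then f x else 0).sum := by
  induction l with
  | nil => rfl
  | cons x t ih =>
    rw [List.filter_cons]
    split_ifs with h
    · simp [ih, h]
    · simp [ih, h]

theorem dominating_val (flags : List Bool) (q : Query) (P : List Point) :
    (dominating flags q P).val = P.filter fun p => below flags q.keys p.keys := by
  induction P with
  | nil => rfl
  | cons p t ih =>
    simp only [dominating, val_bind, ih, List.filter_cons, below]
    split_ifs <;> simp

theorem dominating_time (flags : List Bool) (q : Query) (P : List Point) :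
    (dominating flags q P).time ≤ (flags.length + 2) * P.length + 1 := by
  induction P with
  | nil => simp [dominating]
  | cons p t ih =>
    have := domin_time flags q.keys p.keys
    simp only [dominating, time_bind, List.length_cons, mul_add, mul_one]
    split_ifs <;> simp <;> nlinarith

theorem splitPoints_val (strict : Bool) (m : EReal) (P : List Point) :
    (splitPoints strict m P).val =
      (P.filter fun p => !keyRel strict m p.head, P.filter fun p => keyRel strict m p.head) := by
  induction P with
  | nil => rfl
  | cons p t ih =>
    simp only [splitPoints, val_bind, ih, List.filter_cons, val_op]
    by_cases h : keyRel strict m p.head <;> simp [h]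

theorem splitPoints_time (strict : Bool) (m : EReal) (P : List Point) :
    (splitPoints strict m P).time = 2 * P.length + 1 := by
  induction P with
  | nil => rfl
  | cons p t ih =>
    simp only [splitPoints, time_bind, ih, val_op, time_op, List.length_cons]
    cases keyRel strict m p.head <;> simp <;> ring

theorem lastHead_val (Q : List Query) (hQ : Q ≠ []) : (lastHead Q).val = (Q.getLast hQ).head := by
  induction Q with
  | nil => exact absurd rfl hQ
  | cons q t ih =>
    cases t with
    | nil => rfl
    | cons q' t => simpa [lastHead] using ih (by simp)

theorem lastHead_time (Q : List Query) : (lastHead Q).time ≤ Q.length + 1 := by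
  induction Q with
  | nil => simp [lastHead]
  | cons q t ih =>
    cases t with
    | nil => simp [lastHead]
    | cons q' t => simp [lastHead] at ih ⊢; omega

theorem crossRec_nil_queries (ε : ℝ) (flags : List Bool) (P : List Point) (ξ : Array ℝ) :
    crossRec ε flags [] P ξ = op ξ := by
  rw [crossRec]

theorem crossRec_nil_flags (ε : ℝ) (q : Query) (Q : List Query) (P : List Point) (ξ : Array ℝ) :
    crossRec ε [] (q :: Q) P ξ = (do
      let σ ← sumPoints ε P
      addQueries ε σ (q :: Q) ξ) := by
  rw [crossRec]

theorem crossRec_singleton (ε : ℝ) (b : Bool) (bs : List Bool) (q : Query) (P : List Point)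
    (ξ : Array ℝ) :
    crossRec ε (b :: bs) [q] P ξ = (do
      let D ← dominating (b :: bs) q P
      let σ ← sumPoints ε D
      addQueries ε σ [q] ξ) := by
  rw [crossRec]

theorem crossRec_cons_cons (ε : ℝ) (b : Bool) (bs : List Bool) (q₁ q₂ : Query) (Q : List Query)
    (P : List Point) (ξ : Array ℝ) :
    crossRec ε (b :: bs) (q₁ :: q₂ :: Q) P ξ = (do
      let sQ ← msort Query.head (q₁ :: q₂ :: Q)
      let sP ← msort Point.head P
      let qs ← halve sQ
      let m ← lastHead qs.1
      let ps ← splitPoints b m sP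
      let ξ₁ ← crossRec ε (b :: bs) qs.1 ps.1 ξ
      let ξ₂ ← crossRec ε (b :: bs) qs.2 ps.2 ξ₁
      let qT ← mapOp (fun q => { q with keys := q.keys.tail }) qs.1
      let pT ← mapOp (fun p => { p with keys := p.keys.tail }) ps.2
      crossRec ε bs qT pT ξ₂) := by
  rw [crossRec]; rfl

/-- The number that `crossRec` adds to the cell `i`. -/
def crossSum (ε : ℝ) (flags : List Bool) (Q : List Query) (P : List Point) (i : ℕ) : ℝ :=
  (Q.map fun q => if q.idx = i then Real.exp (-q.dist / ε) *
    (P.map fun p => if below flags q.keys p.keys then Real.exp (-p.dist / ε) * p.wt else 0).sum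
    else 0).sum

theorem crossSum_perm (ε : ℝ) (flags : List Bool) {Q Q' : List Query} {P P' : List Point}
    (hQ : Q.Perm Q') (hP : P.Perm P') (i : ℕ) :
    crossSum ε flags Q P i = crossSum ε flags Q' P' i := by
  unfold crossSum
  rw [(hQ.map _).sum_eq]
  congr 1
  apply List.map_congr_left
  intro q _
  rw [(hP.map _).sum_eq]

theorem crossSum_append (ε : ℝ) (flags : List Bool) (Q Q' : List Query) (P : List Point) (i : ℕ) :
    crossSum ε flags (Q ++ Q') P i = crossSum ε flags Q P i + crossSum ε flags Q' P i := by
  simp [crossSum]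

theorem crossSum_append_points (ε : ℝ) (flags : List Bool) (Q : List Query) (P P' : List Point)
    (i : ℕ) :
    crossSum ε flags Q (P ++ P') i = crossSum ε flags Q P i + crossSum ε flags Q P' i := by
  unfold crossSum
  rw [← List.sum_map_add]
  congr 1
  apply List.map_congr_left
  intro q hq
  split_ifs
  · simp [mul_add]
  · simp

theorem crossSum_eq_zero (ε : ℝ) {flags : List Bool} {Q : List Query} {P : List Point} (i : ℕ)
    (h : ∀ q ∈ Q, ∀ p ∈ P, below flags q.keys p.keys = false) : crossSum ε flags Q P i = 0 := by
  apply List.sum_eq_zero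
  intro r hr
  obtain ⟨q, hq, rfl⟩ := List.mem_map.1 hr
  split_ifs
  · rw [List.sum_eq_zero, mul_zero]
    intro r hr
    obtain ⟨p, hp, rfl⟩ := List.mem_map.1 hr
    simp [h q hq p hp]
  · rfl

/-- For the pairs of rows below and columns above the median: when the first comparison succeeds for
every pair, it may be forgotten. -/
theorem crossSum_tail (ε : ℝ) {b : Bool} {bs : List Bool} {Q : List Query} {P : List Point} (i : ℕ)
    (h : ∀ q ∈ Q, ∀ p ∈ P, below (b :: bs) q.keys p.keys = below bs q.keys.tail p.keys.tail) :
    crossSum ε bs (Q.map fun q => { q with keys := q.keys.tail })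
      (P.map fun p => { p with keys := p.keys.tail }) i = crossSum ε (b :: bs) Q P i := by
  unfold crossSum
  simp only [List.map_map]
  congr 1
  apply List.map_congr_left
  intro q hq
  simp only [Function.comp_apply]
  congr 3
  apply List.map_congr_left
  intro p hp
  simp only [Function.comp_apply, h q hq p hp]

/-- Transitivity, valid for both kinds of comparison. With its contrapositive `keyRel_of_ge`, it
allows ties with the median to lie on either side of the cut of the queries. -/
theorem keyRel_of_le {b : Bool} {w m z : EReal} (hw : w ≤ m) (hz : keyRel b m z = true) :
    keyRel b w z = true := by
  cases b <;> simp only [keyRel, if_true, decide_eq_true_eq, Bool.false_eq_true, if_false] at *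
  · exact hw.trans hz
  · exact hw.trans_lt hz

theorem keyRel_of_ge {b : Bool} {w m z : EReal} (hw : m ≤ w) (hz : keyRel b m z = false) :
    keyRel b w z = false := by
  rw [← Bool.not_eq_true] at *
  exact fun h => hz (keyRel_of_le hw h)

/-- The divide-and-conquer identity behind `crossRec`. -/
theorem crossSum_split (ε : ℝ) {b : Bool} {bs : List Bool} {Q₁ Q₂ : List Query} {P : List Point}
    (m : EReal) (i : ℕ) (hk₁ : ∀ q ∈ Q₁, q.keys.length = bs.length + 1)
    (hk₂ : ∀ q ∈ Q₂, q.keys.length = bs.length + 1)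
    (hkP : ∀ p ∈ P, p.keys.length = bs.length + 1)
    (h₁ : ∀ q ∈ Q₁, q.head ≤ m) (h₂ : ∀ q ∈ Q₂, m ≤ q.head) :
    crossSum ε (b :: bs) (Q₁ ++ Q₂) P i =
      crossSum ε (b :: bs) Q₁ (P.filter fun p => !keyRel b m p.head) i +
      crossSum ε (b :: bs) Q₂ (P.filter fun p => keyRel b m p.head) i +
      crossSum ε bs (Q₁.map fun q => { q with keys := q.keys.tail })
        ((P.filter fun p => keyRel b m p.head).map fun p => { p with keys := p.keys.tail }) i := by
  have hP : P.Perm ((P.filter fun p => keyRel b m p.head) ++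
      (P.filter fun p => !keyRel b m p.head)) :=
    (List.filter_append_perm (fun p : Point => keyRel b m p.head) P).symm
  rw [crossSum_tail (b := b), crossSum_append,
    crossSum_perm ε _ (List.Perm.refl Q₁) hP, crossSum_perm ε _ (List.Perm.refl Q₂) hP,
    crossSum_append_points, crossSum_append_points,
    crossSum_eq_zero ε (Q := Q₂) (P := P.filter fun p => !keyRel b m p.head)]
  · ring
  -- A row at or above the median and a column that is not above it: the first comparison fails, so
  -- the pair contributes nothing.
  · intro q hq p hp
    rw [List.mem_filter] at hp
    rw [below_cons _ _ _ _ (hk₂ q hq) (hkP p hp.1)]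
    have : keyRel b (q.keys.headD 0) (p.keys.headD 0) = false :=
      keyRel_of_ge (h₂ q hq) ((Bool.not_eq_true' _).mp hp.2)
    rw [this, Bool.false_and]
  -- A row at or below the median and a column above it: the first comparison holds automatically.
  · intro q hq p hp
    rw [List.mem_filter] at hp
    rw [below_cons _ _ _ _ (hk₁ q hq) (hkP p hp.1)]
    have : keyRel b (q.keys.headD 0) (p.keys.headD 0) = true :=
      keyRel_of_le (h₁ q hq) hp.2
    rw [this, Bool.true_and]

/-- Lexicographic induction on the number of coordinates and the number of queries, with
`crossSum_split` as the inductive step. Sorting is invisible because `crossSum` is invariant under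
permutations. -/
theorem crossRec_val (ε : ℝ) (flags : List Bool) (Q : List Query) (P : List Point) (ξ : Array ℝ)
    (hQ : ∀ q ∈ Q, q.keys.length = flags.length) (hP : ∀ p ∈ P, p.keys.length = flags.length)
    (hi : ∀ q ∈ Q, q.idx < ξ.size) :
    (crossRec ε flags Q P ξ).val.size = ξ.size ∧
    ∀ i, (crossRec ε flags Q P ξ).val.getD i 0 = ξ.getD i 0 + crossSum ε flags Q P i := by
  induction flags generalizing Q P ξ with
  | nil =>
    match Q, hi with
    | [], _ => simp [crossRec_nil_queries, crossSum]
    | q :: Q, hi =>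
      rw [crossRec_nil_flags]
      simp only [val_bind]
      refine ⟨addQueries_val_size _ _ _ _, fun i => ?_⟩
      rw [addQueries_val_getD _ _ _ _ hi, sumPoints_val]
      simp [crossSum, below_nil]
  | cons b bs ihb =>
    induction hn : Q.length using Nat.strong_induction_on generalizing Q P ξ with
    | _ k ih =>
    match Q, hi, hQ, hn with
    | [], _, _, _ => simp [crossRec_nil_queries, crossSum]
    | [q], hi, _, _ =>
      rw [crossRec_singleton]
      simp only [val_bind]
      refine ⟨addQueries_val_size _ _ _ _, fun i => ?_⟩
      rw [addQueries_val_getD _ _ _ _ hi, sumPoints_val, dominating_val]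
      simp only [crossSum, List.map_cons, List.map_nil, List.sum_cons, List.sum_nil, add_zero]
      rw [sum_map_filter]
    | q₁ :: q₂ :: Q, hi, hQ, hn =>
      rw [crossRec_cons_cons]
      simp only [val_bind, halve_val, splitPoints_val, mapOp_val]
      set L := q₁ :: q₂ :: Q
      set sQ := (msort Query.head L).val
      set sP := (msort Point.head P).val
      have hL : 2 ≤ L.length := by simp [L]
      have pQ : sQ.Perm L := msort_perm _ _
      have pP : sP.Perm P := msort_perm _ _
      have oQ : sQ.Pairwise fun a b => a.head ≤ b.head := msort_sorted _ _
      set r := (sQ.length + 1) / 2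
      have hl : sQ.length = L.length := pQ.length_eq
      have e1 : (sQ.take r).length = r := by rw [List.length_take]; omega
      have e2 : (sQ.drop r).length = sQ.length - r := List.length_drop
      have hne : sQ.take r ≠ [] := List.ne_nil_of_length_pos (by omega)
      set m := (lastHead (sQ.take r)).val
      have hm : m = ((sQ.take r).getLast hne).head := lastHead_val _ hne
      have mt : ∀ q ∈ sQ.take r, q ∈ L := fun q hq => pQ.mem_iff.1 (List.mem_of_mem_take hq)
      have md : ∀ q ∈ sQ.drop r, q ∈ L := fun q hq => pQ.mem_iff.1 (List.mem_of_mem_drop hq)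
      have mP : ∀ p ∈ sP, p ∈ P := fun p hp => pP.mem_iff.1 hp
      rw [← List.take_append_drop r sQ, List.pairwise_append] at oQ
      -- By sortedness the last entry of the first half is its maximum.
      have h₁ : ∀ q ∈ sQ.take r, q.head ≤ m := by
        intro q hq
        rw [hm]
        have h := oQ.1
        rw [← List.dropLast_append_getLast hne, List.pairwise_append] at h
        rw [← List.dropLast_append_getLast hne, List.mem_append, List.mem_singleton] at hq
        rcases hq with hq | hq
        · exact h.2.2 q hq _ (by simp)
        · rw [← hq]
      have h₂ : ∀ q ∈ sQ.drop r, m ≤ q.head := fun q hq => by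
        rw [hm]
        exact oQ.2.2 _ (List.getLast_mem hne) q hq
      obtain ⟨s₁, g₁⟩ := ih _ (by omega) (sQ.take r) (sP.filter fun p => !keyRel b m p.head) ξ
        (fun q hq => hQ q (mt q hq)) (fun p hp => hP p (mP p (List.mem_of_mem_filter hp)))
        (fun q hq => hi q (mt q hq)) rfl
      set ξ₁ := (crossRec ε (b :: bs) (sQ.take r) (sP.filter fun p => !keyRel b m p.head) ξ).val
      obtain ⟨s₂, g₂⟩ := ih _ (by omega) (sQ.drop r) (sP.filter fun p => keyRel b m p.head) ξ₁
        (fun q hq => hQ q (md q hq)) (fun p hp => hP p (mP p (List.mem_of_mem_filter hp)))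
        (fun q hq => s₁ ▸ hi q (md q hq)) rfl
      set ξ₂ := (crossRec ε (b :: bs) (sQ.drop r) (sP.filter fun p => keyRel b m p.head) ξ₁).val
      obtain ⟨s₃, g₃⟩ := ihb ((sQ.take r).map fun q => { q with keys := q.keys.tail })
        ((sP.filter fun p => keyRel b m p.head).map fun p => { p with keys := p.keys.tail }) ξ₂
        (by
          intro q hq
          obtain ⟨q, hq', rfl⟩ := List.mem_map.1 hq
          simp [hQ q (mt q hq')])
        (by
          intro p hp
          obtain ⟨p, hp', rfl⟩ := List.mem_map.1 hp
          simp [hP p (mP p (List.mem_of_mem_filter hp'))])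
        (by
          intro q hq
          obtain ⟨q, hq', rfl⟩ := List.mem_map.1 hq
          simpa [s₂, s₁] using hi q (mt q hq'))
      refine ⟨s₃.trans (s₂.trans s₁), fun i => ?_⟩
      rw [g₃, g₂, g₁, crossSum_perm ε _ pQ.symm pP.symm]
      conv_rhs => rw [← List.take_append_drop r sQ]
      rw [crossSum_split ε m i (fun q hq => by simpa using hQ q (mt q hq))
        (fun q hq => by simpa using hQ q (md q hq)) (fun p hp => by simpa using hP p (mP p hp))
        h₁ h₂]
      ring

/-! ### Running time of `crossRec` -/

/-- The direct evaluation fits the general bound for all `L` and `h`, so it serves both as the case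
`h = 0` and as the case of a single query at later stages of the induction. -/
theorem crossRec_time_singleton (ε : ℝ) (L h : ℕ) (flags : List Bool) (q : Query)
    (P : List Point) (ξ : Array ℝ) :
    (crossRec ε flags [q] P ξ).time ≤
      (6 * L + 10) * (flags.length + 1) * (h + 2) ^ flags.length * (1 + P.length) := by
  have hpow : 1 ≤ (h + 2) ^ flags.length := Nat.one_le_pow _ _ (by omega)
  have hle : (10 * (flags.length + 1)) * (1 + P.length) ≤
      (6 * L + 10) * (flags.length + 1) * (h + 2) ^ flags.length * (1 + P.length) := by
    refine Nat.mul_le_mul_right _ (le_trans ?_ (Nat.le_mul_of_pos_right _ hpow))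
    exact Nat.mul_le_mul_right _ (by omega)
  refine le_trans ?_ hle
  cases flags with
  | nil =>
    rw [crossRec_nil_flags]
    simp only [time_bind, sumPoints_time, addQueries_time, List.length_cons, List.length_nil]
    omega
  | cons b bs =>
    rw [crossRec_singleton]
    have h1 := dominating_time (b :: bs) q P
    have h2 : (dominating (b :: bs) q P).val.length ≤ P.length := by
      rw [dominating_val]; exact List.length_filter_le _ _
    simp only [time_bind, sumPoints_time, addQueries_time, List.length_cons,
      List.length_nil] at h1 ⊢
    nlinarith

/-- With `B(d,h) = (d+1) (h+2)^d` this reads `1 + B(d+1,h) + B(d,h) ≤ B(d+1,h+1)`: the sorting pass,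
the two recursive calls on complementary halves, and the call with one coordinate fewer. -/
theorem crossRec_recurrence (d h : ℕ) :
    1 + (d + 2) * (h + 2) ^ (d + 1) + (d + 1) * (h + 2) ^ d ≤ (d + 2) * (h + 3) ^ (d + 1) := by
  have h1 : (h + 2) ^ d ≤ (h + 3) ^ d := Nat.pow_le_pow_left (by omega) d
  have h2 : 1 ≤ (h + 2) ^ d := Nat.one_le_pow _ _ (by omega)
  calc 1 + (d + 2) * (h + 2) ^ (d + 1) + (d + 1) * (h + 2) ^ d
      ≤ (d + 2) * (h + 2) ^ (d + 1) + (d + 2) * (h + 2) ^ d := by nlinarith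
    _ = (d + 2) * (h + 3) * (h + 2) ^ d := by ring
    _ ≤ (d + 2) * (h + 3) * (h + 3) ^ d := Nat.mul_le_mul_left _ h1
    _ = (d + 2) * (h + 3) ^ (d + 1) := by ring

/-- Two size parameters are needed. Only the queries are halved exactly, so `h` bounds their
logarithm and decreases, while `L` stays fixed and bounds the cost of sorting the points, which may
all fall on one side. Nonempty query lists keep the bound free of an additive constant. -/
theorem crossRec_time_of_ne_nil (ε : ℝ) (L h : ℕ) (flags : List Bool) (Q : List Query)
    (P : List Point) (ξ : Array ℝ) (hne : Q ≠ []) (hQ : Q.length ≤ 2 ^ h)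
    (hQL : Q.length ≤ 2 ^ L) (hPL : P.length ≤ 2 ^ L) :
    (crossRec ε flags Q P ξ).time ≤
      (6 * L + 10) * (flags.length + 1) * (h + 2) ^ flags.length * (Q.length + P.length) := by
  induction h generalizing flags Q P ξ with
  | zero =>
    match Q, hne, hQ with
    | [q], _, _ => exact crossRec_time_singleton ε L 0 flags q P ξ
    | q₁ :: q₂ :: Q, _, hQ => simp at hQ
  | succ h ih =>
    match flags, Q, hne, hQ with
    | flags, [q], _, _ => exact crossRec_time_singleton ε L (h + 1) flags q P ξ
    | [], q₁ :: q₂ :: Q, _, _ =>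
      rw [crossRec_nil_flags]
      simp only [time_bind, sumPoints_time, addQueries_time, List.length_cons, List.length_nil]
      nlinarith [Nat.zero_le (L * Q.length), Nat.zero_le (L * P.length)]
    | b :: bs, q₁ :: q₂ :: Q, _, hQ =>
      rw [crossRec_cons_cons]
      simp only [time_bind, halve_val, splitPoints_val, mapOp_val, mapOp_time, splitPoints_time]
      set l := q₁ :: q₂ :: Q
      set sQ := (msort Query.head l).val
      set sP := (msort Point.head P).val
      have hl : 2 ≤ l.length := by simp [l]
      have pQ : sQ.length = l.length := (msort_perm _ _).length_eq
      have pP : sP.length = P.length := (msort_perm _ _).length_eq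
      set r := (sQ.length + 1) / 2
      set m := (lastHead (sQ.take r)).val
      set ξ₁ := (crossRec ε (b :: bs) (sQ.take r) (sP.filter fun p => !keyRel b m p.head) ξ).val
      set ξ₂ := (crossRec ε (b :: bs) (sQ.drop r) (sP.filter fun p => keyRel b m p.head) ξ₁).val
      have e1 : (sQ.take r).length = r := by rw [List.length_take]; omega
      have e2 : (sQ.drop r).length = sQ.length - r := List.length_drop
      have hP : (sP.filter fun p => keyRel b m p.head).length +
          (sP.filter fun p => !keyRel b m p.head).length = sP.length := by
        rw [← List.length_append]
        exact (List.filter_append_perm (fun p : Point => keyRel b m p.head) sP).length_eq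
      have hp : 2 ^ (h + 1) = 2 * 2 ^ h := by ring
      have t1 := msort_time_of_ne_nil Query.head L l (by simp [l]) hQL
      have t2 := msort_time Point.head L P hPL
      have t3 := halve_time sQ
      have t4 := lastHead_time (sQ.take r)
      have t5 := ih (b :: bs) (sQ.take r) (sP.filter fun p => !keyRel b m p.head) ξ
        (List.ne_nil_of_length_pos (by omega)) (by omega) (by omega) (by omega)
      have t6 := ih (b :: bs) (sQ.drop r) (sP.filter fun p => keyRel b m p.head) ξ₁
        (List.ne_nil_of_length_pos (by omega)) (by omega) (by omega) (by omega)
      have t7 := ih bs ((sQ.take r).map fun q => { q with keys := q.keys.tail })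
        ((sP.filter fun p => keyRel b m p.head).map fun p => { p with keys := p.keys.tail }) ξ₂
        (List.ne_nil_of_length_pos (by rw [List.length_map]; omega))
        (by rw [List.length_map]; omega) (by rw [List.length_map]; omega)
        (by rw [List.length_map]; omega)
      simp only [List.length_map, List.length_cons] at t5 t6 t7 ⊢
      rw [e1] at t4 t5 t7 ⊢
      rw [e2] at t6
      set x := (sP.filter fun p => keyRel b m p.head).length
      set y := (sP.filter fun p => !keyRel b m p.head).length
      set N := l.length + P.length with hN
      set d := bs.length
      set X := (h + 2) ^ (d + 1)
      set Y := (h + 2) ^ d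
      -- The first two calls receive disjoint parts of the queries and of the points, so their sizes
      -- add up to `N`.
      have t56 : (6 * L + 10) * (d + 1 + 1) * X * (r + y) +
          (6 * L + 10) * (d + 1 + 1) * X * (sQ.length - r + x) =
          (6 * L + 10) * ((d + 2) * X) * N := by
        rw [← mul_add, show r + y + (sQ.length - r + x) = N by omega]; ring
      have t7' : (6 * L + 10) * (d + 1) * Y * (r + x) ≤ (6 * L + 10) * ((d + 1) * Y) * N := by
        rw [mul_assoc (6 * L + 10)]; exact Nat.mul_le_mul_left _ (by omega)
      -- The spare `9 * N` pays for everything at this level other than the recursive calls and the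
      -- main terms of the two sorts.
      have tN : (6 * L + 10) * N = (6 * L + 1) * l.length + (6 * L + 1) * P.length + 9 * N := by
        rw [hN]; ring
      have key : (6 * L + 10) * N + (6 * L + 10) * ((d + 2) * X) * N +
          (6 * L + 10) * ((d + 1) * Y) * N ≤
          (6 * L + 10) * (d + 1 + 1) * (h + 1 + 2) ^ (d + 1) * N := by
        have := Nat.mul_le_mul_left ((6 * L + 10) * N) (crossRec_recurrence d h)
        calc _ = (6 * L + 10) * N * (1 + (d + 2) * X + (d + 1) * Y) := by ring
          _ ≤ _ := this
          _ = _ := by ring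
      refine le_trans ?_ key
      omega

theorem crossRec_time (ε : ℝ) (L : ℕ) (flags : List Bool) (Q : List Query)
    (P : List Point) (ξ : Array ℝ) (hQ : Q.length ≤ 2 ^ L) (hP : P.length ≤ 2 ^ L) :
    (crossRec ε flags Q P ξ).time ≤
      (6 * L + 10) * (flags.length + 1) * (L + 2) ^ flags.length * (Q.length + P.length) + 1 := by
  rcases eq_or_ne Q [] with rfl | h
  · rw [crossRec_nil_queries]; simp
  · exact (crossRec_time_of_ne_nil ε L L flags Q P ξ h hQ hQ hP).trans (Nat.le_succ _)

/-! ### Selecting the least index at which the minimum is attained -/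

/-- Rearranging the inequality separates row data from column data. The entries `x`, `y` may be
infinite: with `a`, `b` finite the differences become `⊥` and `⊤`, and both sides remain equivalent.
Finiteness of `a` and `b` is why rows with an infinite `k`-th entry are left out. -/
theorem ereal_sub_lt_sub_iff {a b : ℝ≥0∞} (ha : a ≠ ⊤) (hb : b ≠ ⊤) (x y : ℝ≥0∞) :
    (a : EReal) - (x : EReal) < (y : EReal) - (b : EReal) ↔ a + b < x + y := by
  lift a to ℝ≥0 using ha
  lift b to ℝ≥0 using hb
  have hb' : ((b : ℝ≥0∞) : EReal) = ((b : ℝ) : EReal) := rfl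
  have ha' : ((a : ℝ≥0∞) : EReal) = ((a : ℝ) : EReal) := rfl
  rw [ha', hb']
  induction x with
  | top =>
    have h1 : ((a : ℝ) : EReal) - ((⊤ : ℝ≥0∞) : EReal) = ⊥ := by simp
    have h2 : (a : ℝ≥0∞) + b < ⊤ := by simp
    rw [h1, top_add]
    simp only [h2, iff_true]
    induction y with
    | top => simp
    | coe y =>
      change ⊥ < ((y : ℝ) : EReal) - ((b : ℝ) : EReal)
      rw [← EReal.coe_sub]
      exact EReal.bot_lt_coe _
  | coe x =>
    have hx : ((x : ℝ≥0∞) : EReal) = ((x : ℝ) : EReal) := rfl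
    rw [hx, ← EReal.coe_sub]
    induction y with
    | top => simp [-EReal.coe_sub, -ENNReal.coe_add]
    | coe y =>
      have hy : ((y : ℝ≥0∞) : EReal) = ((y : ℝ) : EReal) := rfl
      rw [hy, ← EReal.coe_sub, EReal.coe_lt_coe_iff, ← ENNReal.coe_add, ← ENNReal.coe_add,
        ENNReal.coe_lt_coe, ← NNReal.coe_lt_coe, NNReal.coe_add, NNReal.coe_add]
      constructor <;> intro h <;> linarith

theorem ereal_sub_le_sub_iff {a b : ℝ≥0∞} (ha : a ≠ ⊤) (hb : b ≠ ⊤) (x y : ℝ≥0∞) :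
    (a : EReal) - (x : EReal) ≤ (y : EReal) - (b : EReal) ↔ a + b ≤ x + y := by
  lift a to ℝ≥0 using ha
  lift b to ℝ≥0 using hb
  have hb' : ((b : ℝ≥0∞) : EReal) = ((b : ℝ) : EReal) := rfl
  have ha' : ((a : ℝ≥0∞) : EReal) = ((a : ℝ) : EReal) := rfl
  rw [ha', hb']
  induction x with
  | top => simp
  | coe x =>
    have hx : ((x : ℝ≥0∞) : EReal) = ((x : ℝ) : EReal) := rfl
    rw [hx, ← EReal.coe_sub]
    induction y with
    | top => simp
    | coe y =>
      have hy : ((y : ℝ≥0∞) : EReal) = ((y : ℝ) : EReal) := rfl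
      rw [hy, ← EReal.coe_sub, EReal.coe_le_coe_iff, ← ENNReal.coe_add, ← ENNReal.coe_add,
        ENNReal.coe_le_coe, ← NNReal.coe_le_coe, NNReal.coe_add, NNReal.coe_add]
      constructor <;> intro h <;> linarith

theorem fEps_add {ε : ℝ} {a b : ℝ≥0∞} (ha : a ≠ ⊤) (hb : b ≠ ⊤) :
    fEps ε (a + b) = Real.exp (-a.toReal / ε) * Real.exp (-b.toReal / ε) := by
  rw [fEps, if_neg (by simp [ha, hb]), ← Real.exp_add, ENNReal.toReal_add ha hb]
  congr 1
  ring

/-- The flags of the coordinates for the index `k` of a separator of size `s`. -/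
def flagsOf (k s : ℕ) : List Bool := List.replicate k true ++ List.replicate (s - 1 - k) false

theorem length_flagsOf {k s : ℕ} (h : k < s) : (flagsOf k s).length = s - 1 := by
  simp [flagsOf]; omega

/-- The vector of a query. -/
def queryKeys (k : ℕ) (row : List ℝ≥0∞) : List EReal :=
  (row.eraseIdx k).map fun x : ℝ≥0∞ => (row.getD k ⊤ : EReal) - (x : EReal)

/-- The vector of a point. -/
def pointKeys (k : ℕ) (row : List ℝ≥0∞) : List EReal :=
  (row.eraseIdx k).map fun x : ℝ≥0∞ => (x : EReal) - (row.getD k ⊤ : EReal)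

theorem length_queryKeys {k : ℕ} {row : List ℝ≥0∞} (h : k < row.length) :
    (queryKeys k row).length = row.length - 1 := by
  simp [queryKeys, List.length_eraseIdx, h]

theorem length_pointKeys {k : ℕ} {row : List ℝ≥0∞} (h : k < row.length) :
    (pointKeys k row).length = row.length - 1 := by
  simp [pointKeys, List.length_eraseIdx, h]

theorem below_false_iff (f g : ℝ≥0∞ → EReal) (a b : List ℝ≥0∞) (h : a.length = b.length) :
    below (List.replicate a.length false) (a.map f) (b.map g) = true ↔
      ∀ l < a.length, f (a.getD l ⊤) ≤ g (b.getD l ⊤) := by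
  induction a generalizing b with
  | nil => simp [below_nil]
  | cons x t ih =>
    match b, h with
    | y :: u, h =>
      simp only [List.length_cons, Nat.add_right_cancel_iff] at h
      rw [List.length_cons, List.replicate_succ, below_cons _ _ _ _ (by simp) (by simp [h]),
        Bool.and_eq_true, List.map_cons, List.map_cons, List.headD_cons, List.headD_cons,
        List.tail_cons, List.tail_cons, ih u h, Nat.forall_lt_succ_left]
      simp [keyRel]

/-- Deleting entry `k` shifts the later indices down by one, so the `k` strict flags meet the
indices below `k` and the weak flags those above it. This restates the comparison in the original
indices. -/
theorem below_flagsOf_iff (f g : ℝ≥0∞ → EReal) (k s : ℕ) (a b : List ℝ≥0∞) (hk : k < s)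
    (ha : a.length = s) (hb : b.length = s) :
    below (flagsOf k s) ((a.eraseIdx k).map f) ((b.eraseIdx k).map g) = true ↔
      (∀ l < k, f (a.getD l ⊤) < g (b.getD l ⊤)) ∧
      ∀ l < s, k < l → f (a.getD l ⊤) ≤ g (b.getD l ⊤) := by
  induction k generalizing a b s with
  | zero =>
    match a, b, ha, hb with
    | x :: t, y :: u, ha, hb =>
      simp only [List.length_cons] at ha hb
      subst ha
      have := below_false_iff f g t u (by omega)
      simp only [flagsOf, List.replicate_zero, List.nil_append, List.eraseIdx_cons_zero,
        Nat.add_sub_cancel, Nat.sub_zero, this]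
      constructor
      · refine fun h => ⟨by simp, fun l hl hl' => ?_⟩
        obtain ⟨l, rfl⟩ := Nat.exists_eq_succ_of_ne_zero hl'.ne'
        simpa using h l (by omega)
      · intro h l hl
        simpa using h.2 (l + 1) (by omega) (by omega)
    | [], _, ha, _ => simp at ha; omega
    | _ :: _, [], _, hb => simp at hb; omega
  | succ k ih =>
    match a, b, ha, hb with
    | [], _, ha, _ => simp at ha; omega
    | _ :: _, [], _, hb => simp at hb; omega
    | x :: t, y :: u, ha, hb =>
      simp only [List.length_cons] at ha hb
      obtain ⟨s, rfl⟩ : ∃ s', s = s' + 1 := ⟨t.length, ha.symm⟩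
      have hf : flagsOf (k + 1) (s + 1) = true :: flagsOf k s := by
        rw [flagsOf, flagsOf, List.replicate_succ, List.cons_append,
          show s + 1 - 1 - (k + 1) = s - 1 - k by omega]
      have hks : k < s := by omega
      have l1 : (t.eraseIdx k).length = s - 1 := by
        rw [List.length_eraseIdx_of_lt (by omega)]; omega
      have l2 : (u.eraseIdx k).length = s - 1 := by
        rw [List.length_eraseIdx_of_lt (by omega)]; omega
      rw [hf, List.eraseIdx_cons_succ, List.eraseIdx_cons_succ, List.map_cons, List.map_cons,
        below_cons _ _ _ _ (by simp [length_flagsOf hks, l1]) (by simp [length_flagsOf hks, l2]),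
        List.headD_cons, List.headD_cons, List.tail_cons, List.tail_cons, Bool.and_eq_true,
        ih s t u hks (by omega) (by omega), Nat.forall_lt_succ_left (n := k)]
      simp only [keyRel, if_true, decide_eq_true_eq, List.getD_cons_zero, List.getD_cons_succ,
        Nat.forall_lt_succ_left (n := s), Nat.not_lt_zero, false_imp_iff, true_and,
        Nat.succ_lt_succ_iff, and_assoc]

/-- The contribution of index `k` to the entry of the matrix `[f_ε(min_k (a_k + b_k))]` that
belongs to the rows `a` and `b`. -/
def indexTerm (ε : ℝ) (k s : ℕ) (a b : List ℝ≥0∞) : ℝ :=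
  if a.getD k ⊤ = ⊤ then 0 else if b.getD k ⊤ = ⊤ then 0 else
    if below (flagsOf k s) (queryKeys k a) (pointKeys k b) then
      Real.exp (-(a.getD k ⊤).toReal / ε) * Real.exp (-(b.getD k ⊤).toReal / ε) else 0

-- Rows left out because of an infinite entry do no harm, since `fEps` vanishes at `⊤`; otherwise
-- the test says that `k` is the least minimizer of the sums.
open Classical in
theorem indexTerm_eq (ε : ℝ) {k s : ℕ} {a b : List ℝ≥0∞} (hk : k < s) (ha : a.length = s)
    (hb : b.length = s) :
    indexTerm ε k s a b =
      if (∀ l < k, a.getD k ⊤ + b.getD k ⊤ < a.getD l ⊤ + b.getD l ⊤) ∧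
        (∀ l < s, k < l → a.getD k ⊤ + b.getD k ⊤ ≤ a.getD l ⊤ + b.getD l ⊤) then
        fEps ε (a.getD k ⊤ + b.getD k ⊤) else 0 := by
  rw [indexTerm]
  by_cases h1 : a.getD k ⊤ = ⊤
  · rw [if_pos h1, h1, top_add, fEps, if_pos rfl, ite_self]
  by_cases h2 : b.getD k ⊤ = ⊤
  · rw [if_neg h1, if_pos h2, h2, add_top, fEps, if_pos rfl, ite_self]
  rw [if_neg h1, if_neg h2, fEps_add h1 h2, queryKeys, pointKeys]
  refine if_congr ?_ rfl rfl
  rw [below_flagsOf_iff _ _ k s a b hk ha hb]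
  simp only [ereal_sub_lt_sub_iff h1 h2, ereal_sub_le_sub_iff h1 h2]

/-- Exactly the least index at which the minimum is attained contributes. -/
theorem sum_indexTerm (ε : ℝ) {s : ℕ} {a b : List ℝ≥0∞} (ha : a.length = s)
    (hb : b.length = s) :
    ∑ k ∈ Finset.range s, indexTerm ε k s a b =
      fEps ε (⨅ l : Fin s, (a.getD l ⊤ + b.getD l ⊤)) := by
  classical
  set c : ℕ → ℝ≥0∞ := fun l => a.getD l ⊤ + b.getD l ⊤ with hc
  rw [Finset.sum_congr rfl fun k hk => indexTerm_eq ε (Finset.mem_range.1 hk) ha hb]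
  rcases Nat.eq_zero_or_pos s with rfl | hs
  -- With an empty separator the infimum is `⊤` and both sides vanish.
  · simp [fEps]
  -- `Nat.find` picks the least minimizer; every smaller index is not a minimizer, hence has a
  -- strictly larger sum.
  have hex : ∃ k, k < s ∧ ∀ l < s, c k ≤ c l := by
    obtain ⟨k, hk, h⟩ := Finset.exists_min_image (Finset.range s) c ⟨0, by simpa⟩
    exact ⟨k, by simpa using hk, fun l hl => h l (by simpa using hl)⟩
  obtain ⟨hk, hmin⟩ := Nat.find_spec hex
  set k := Nat.find hex
  have hlt : ∀ l < k, c k < c l := by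
    intro l hl
    have := Nat.find_min hex hl
    push Not at this
    obtain ⟨l', h1, h2⟩ := this (hl.trans hk)
    exact (hmin l' h1).trans_lt h2
  have hinf : ⨅ l : Fin s, c l = c k :=
    le_antisymm (iInf_le (fun l : Fin s => c l) ⟨k, hk⟩) (le_iInf fun l => hmin l l.2)
  rw [Finset.sum_eq_single k, if_pos ⟨hlt, fun l hl _ => hmin l hl⟩, hinf]
  · intro j hj hjk
    rw [Finset.mem_range] at hj
    rw [if_neg]
    rintro ⟨h1, h2⟩
    rcases lt_or_gt_of_ne hjk with h | h
    · exact absurd (h2 k hk h) (not_le.2 (hlt j h))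
    · exact absurd (h1 k h) (not_lt.2 (hmin j hj))
  · intro h
    exact absurd (Finset.mem_range.2 hk) h

/-! ### Queries, points and correctness of `crossHalf` -/

theorem mkPoints_cons (k : ℕ) (row : List ℝ≥0∞) (rows : List (List ℝ≥0∞)) (v : ℝ) (vs : List ℝ) :
    (mkPoints k (row :: rows) (v :: vs)).val =
      if row.getD k ⊤ = ⊤ then (mkPoints k rows vs).val else
        ⟨(row.getD k ⊤).toReal, v, pointKeys k row⟩ :: (mkPoints k rows vs).val := by
  simp only [mkPoints, val_bind, val_op, nth_val, decide_eq_true_eq]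
  split_ifs
  · rfl
  · simp [skipMapOp_val, pointKeys]

theorem mkQueries_cons (k i : ℕ) (row : List ℝ≥0∞) (rows : List (List ℝ≥0∞)) :
    (mkQueries k i (row :: rows)).val =
      if row.getD k ⊤ = ⊤ then (mkQueries k (i + 1) rows).val else
        ⟨i, (row.getD k ⊤).toReal, queryKeys k row⟩ :: (mkQueries k (i + 1) rows).val := by
  simp only [mkQueries, val_bind, val_op, nth_val, decide_eq_true_eq]
  split_ifs
  · rfl
  · simp [skipMapOp_val, queryKeys]

/-- Omitting a column amounts to a zero summand, so sums over the points become sums over all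
columns. -/
theorem mkPoints_sum {κ : Type} (k : ℕ) (B : List κ) (β : κ → List ℝ≥0∞) (w : κ → ℝ)
    (F : Point → ℝ) :
    ((mkPoints k (B.map β) (B.map w)).val.map F).sum =
      (B.map fun j => if (β j).getD k ⊤ = ⊤ then 0 else
        F ⟨((β j).getD k ⊤).toReal, w j, pointKeys k (β j)⟩).sum := by
  induction B with
  | nil => simp [mkPoints]
  | cons j t ih =>
    simp only [List.map_cons, mkPoints_cons, List.sum_cons, ← ih]
    split_ifs <;> simp

theorem length_mkPoints (k : ℕ) (BD : List (List ℝ≥0∞)) (v : List ℝ) :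
    (mkPoints k BD v).val.length ≤ BD.length := by
  induction BD generalizing v with
  | nil => simp [mkPoints]
  | cons row rows ih =>
    cases v with
    | nil => simp [mkPoints]
    | cons x u =>
      have := ih u
      rw [mkPoints_cons]
      split_ifs <;> simp <;> omega

theorem length_mkQueries (k i : ℕ) (AD : List (List ℝ≥0∞)) :
    (mkQueries k i AD).val.length ≤ AD.length := by
  induction AD generalizing i with
  | nil => simp [mkQueries]
  | cons row rows ih =>
    have := ih (i + 1)
    rw [mkQueries_cons]
    split_ifs <;> simp <;> omega

theorem keys_of_mem_mkPoints {k s : ℕ} (hk : k < s) {BD : List (List ℝ≥0∞)} {v : List ℝ}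
    (h : ∀ b ∈ BD, b.length = s) {p : Point} (hp : p ∈ (mkPoints k BD v).val) :
    p.keys.length = s - 1 := by
  induction BD generalizing v with
  | nil => simp [mkPoints] at hp
  | cons row rows ih =>
    cases v with
    | nil => simp [mkPoints] at hp
    | cons x u =>
      have hr : row.length = s := h row List.mem_cons_self
      have ih' := @ih u fun b hb => h b (List.mem_cons_of_mem _ hb)
      rw [mkPoints_cons] at hp
      split_ifs at hp
      · exact ih' hp
      · rcases List.mem_cons.1 hp with rfl | hp
        · rw [length_pointKeys (by omega), hr]
        · exact ih' hp

theorem keys_of_mem_mkQueries {k s : ℕ} (hk : k < s) {AD : List (List ℝ≥0∞)} {i : ℕ}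
    (h : ∀ a ∈ AD, a.length = s) {q : Query} (hq : q ∈ (mkQueries k i AD).val) :
    q.keys.length = s - 1 := by
  induction AD generalizing i with
  | nil => simp [mkQueries] at hq
  | cons row rows ih =>
    have hr : row.length = s := h row List.mem_cons_self
    have ih' := @ih (i + 1) fun b hb => h b (List.mem_cons_of_mem _ hb)
    rw [mkQueries_cons] at hq
    split_ifs at hq
    · exact ih' hq
    · rcases List.mem_cons.1 hq with rfl | hq
      · rw [length_queryKeys (by omega), hr]
      · exact ih' hq

theorem idx_of_mem_mkQueries {k i : ℕ} {AD : List (List ℝ≥0∞)} {q : Query}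
    (hq : q ∈ (mkQueries k i AD).val) : i ≤ q.idx ∧ q.idx < i + AD.length := by
  induction AD generalizing i with
  | nil => simp [mkQueries] at hq
  | cons row rows ih =>
    rw [mkQueries_cons] at hq
    rw [List.length_cons]
    split_ifs at hq
    · have := ih hq; omega
    · rcases List.mem_cons.1 hq with rfl | hq
      · simp
      · have := ih hq; omega

/-- The queries carry the consecutive row numbers `i, i+1, ...`, so at most one of them writes to a
given cell. -/
theorem mkQueries_sum (k i j : ℕ) (AD : List (List ℝ≥0∞)) (hj : j < AD.length)
    (F : Query → ℝ) :
    ((mkQueries k i AD).val.map fun q => if q.idx = i + j then F q else 0).sum =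
      if AD[j].getD k ⊤ = ⊤ then 0 else
        F ⟨i + j, (AD[j].getD k ⊤).toReal, queryKeys k AD[j]⟩ := by
  induction AD generalizing i j with
  | nil => simp at hj
  | cons row rows ih =>
    rw [mkQueries_cons]
    cases j with
    | zero =>
      have h0 : ((mkQueries k (i + 1) rows).val.map
          fun q => if q.idx = i + 0 then F q else 0).sum = 0 := by
        apply List.sum_eq_zero
        intro r hr
        obtain ⟨q, hq, rfl⟩ := List.mem_map.1 hr
        have := idx_of_mem_mkQueries hq
        rw [if_neg (by omega)]
      simp only [List.getElem_cons_zero]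
      split_ifs
      · exact h0
      · rw [List.map_cons, List.sum_cons, h0]; simp
    | succ j =>
      have := ih (i + 1) j (by simpa using hj)
      rw [show i + 1 + j = i + (j + 1) by ring] at this
      rw [List.getElem_cons_succ, ← this]
      split_ifs
      · rfl
      · simp

theorem crossSum_mk {κ : Type} (ε : ℝ) (k s j : ℕ) (AD : List (List ℝ≥0∞)) (hj : j < AD.length)
    (B : List κ) (β : κ → List ℝ≥0∞) (w : κ → ℝ) :
    crossSum ε (flagsOf k s) (mkQueries k 0 AD).val (mkPoints k (B.map β) (B.map w)).val j =
      (B.map fun j' => indexTerm ε k s AD[j] (β j') * w j').sum := by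
  have := mkQueries_sum k 0 j AD hj fun q => Real.exp (-q.dist / ε) *
    ((mkPoints k (B.map β) (B.map w)).val.map fun p =>
      if below (flagsOf k s) q.keys p.keys then Real.exp (-p.dist / ε) * p.wt else 0).sum
  rw [Nat.zero_add] at this
  rw [crossSum, this]
  split_ifs with h
  · symm
    apply List.sum_eq_zero
    intro r hr
    obtain ⟨q, hq, rfl⟩ := List.mem_map.1 hr
    rw [indexTerm, if_pos h, zero_mul]
  · rw [mkPoints_sum, ← List.sum_map_mul_left]
    congr 1
    apply List.map_congr_left
    intro j' _
    rw [indexTerm, if_neg h]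
    simp only
    split_ifs <;> ring

theorem mkFlags_val (k s : ℕ) : (mkFlags k s).val = flagsOf k s := rfl

theorem crossLoop_val {κ : Type} (ε : ℝ) (s : ℕ) (AD : List (List ℝ≥0∞)) (B : List κ)
    (β : κ → List ℝ≥0∞) (w : κ → ℝ) (hA : ∀ a ∈ AD, a.length = s)
    (hB : ∀ j ∈ B, (β j).length = s) (ξ : Array ℝ) (hξ : ξ.size = AD.length) (k : ℕ) (hk : k ≤ s) :
    (crossLoop ε s AD (B.map β) (B.map w) k ξ).val.size = AD.length ∧
    ∀ (j : ℕ) (hj : j < AD.length),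
      (crossLoop ε s AD (B.map β) (B.map w) k ξ).val.getD j 0 = ξ.getD j 0 +
        (B.map fun j' => (∑ k' ∈ Finset.range k, indexTerm ε k' s AD[j] (β j')) * w j').sum := by
  induction k with
  | zero => simp [crossLoop, hξ]
  | succ k ih =>
    obtain ⟨h1, h2⟩ := ih (by omega)
    simp only [crossLoop, val_bind, mkFlags_val]
    obtain ⟨h3, h4⟩ := crossRec_val ε (flagsOf k s) (mkQueries k 0 AD).val
      (mkPoints k (B.map β) (B.map w)).val (crossLoop ε s AD (B.map β) (B.map w) k ξ).val
      (fun q hq => by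
        rw [keys_of_mem_mkQueries (by omega) hA hq, length_flagsOf (by omega)])
      (fun p hp => by
        rw [keys_of_mem_mkPoints (s := s) (by omega) (by simpa using hB) hp,
          length_flagsOf (by omega)])
      (fun q hq => by
        rw [h1]
        simpa using (idx_of_mem_mkQueries hq).2)
    refine ⟨h3.trans h1, fun j hj => ?_⟩
    rw [h4, h2 j hj, crossSum_mk ε k s j AD hj, add_assoc, ← List.sum_map_add]
    simp only [Finset.sum_range_succ, add_mul]

/-- `crossHalf` multiplies with the matrix of the numbers `f_ε(min_k (a_k + b_k))`. -/
theorem crossHalf_val {ι κ : Type} (ε : ℝ) (s : ℕ) (A : List ι) (B : List κ)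
    (α : ι → List ℝ≥0∞) (β : κ → List ℝ≥0∞) (w : κ → ℝ) (hA : ∀ i ∈ A, (α i).length = s)
    (hB : ∀ j ∈ B, (β j).length = s) :
    (crossHalf ε s (A.map α) (B.map β) (B.map w)).val =
      A.map fun i => (B.map fun j =>
        fEps ε (⨅ l : Fin s, ((α i).getD l ⊤ + (β j).getD l ⊤)) * w j).sum := by
  simp only [crossHalf, val_bind, len_val, zeros, val_bulk]
  obtain ⟨h1, h2⟩ := crossLoop_val ε s (A.map α) B β w (by simpa using hA) hB
    (Array.replicate (A.map α).length 0) (by simp) s le_rfl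
  apply List.ext_getElem
  · simpa using h1
  · intro j hj hj'
    have hjA : j < A.length := by simpa using hj'
    have := h2 j (by simpa using hjA)
    rw [Array.getElem_toList, List.getElem_map]
    rw [Array.getD_eq_getD_getElem?, Array.getElem?_eq_getElem (by simpa using hj),
      Option.getD_some] at this
    rw [this]
    simp only [List.getElem_map]
    rw [show (Array.replicate (A.map α).length (0 : ℝ)).getD j 0 = 0 by
      simp [Array.getD, hjA], zero_add]
    congr 1
    apply List.map_congr_left
    intro j' hj'
    rw [sum_indexTerm ε (hA _ (List.getElem_mem hjA)) (hB j' hj')]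

/-! ### Running time of `crossHalf` -/

theorem mkQueries_time (s k i : ℕ) (AD : List (List ℝ≥0∞)) (h : ∀ a ∈ AD, a.length ≤ s) :
    (mkQueries k i AD).time ≤ (3 * s + 6) * AD.length + 1 := by
  induction AD generalizing i with
  | nil => simp [mkQueries]
  | cons row rows ih =>
    have h1 := ih (i + 1) fun a ha => h a (List.mem_cons_of_mem _ ha)
    have h2 := nth_time row k
    have h3 := skipMapOp_time (fun x : ℝ≥0∞ => ((nth row k).val : EReal) - (x : EReal)) k row
    have h4 := h row List.mem_cons_self
    simp only [mkQueries, time_bind, time_op, val_op, List.length_cons, mul_add, mul_one,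
      decide_eq_true_eq]
    split_ifs <;> simp only [time_bind, time_op] <;> omega

theorem mkPoints_time (s k : ℕ) (BD : List (List ℝ≥0∞)) (v : List ℝ)
    (h : ∀ b ∈ BD, b.length ≤ s) :
    (mkPoints k BD v).time ≤ (3 * s + 6) * BD.length + 1 := by
  induction BD generalizing v with
  | nil => simp [mkPoints]
  | cons row rows ih =>
    cases v with
    | nil => simp [mkPoints]
    | cons x u =>
      have h1 := ih u fun a ha => h a (List.mem_cons_of_mem _ ha)
      have h2 := nth_time row k
      have h3 := skipMapOp_time (fun x : ℝ≥0∞ => (x : EReal) - ((nth row k).val : EReal)) k row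
      have h4 := h row List.mem_cons_self
      simp only [mkPoints, time_bind, time_op, val_op, List.length_cons, mul_add, mul_one,
        decide_eq_true_eq]
      split_ifs <;> simp only [time_bind, time_op] <;> omega

/-- One round is a call of `crossRec` plus the construction of its input. The latter is linear in
the row lengths and raises the constant `6L + 10` to `6L + 16`. -/
theorem crossLoop_time (ε : ℝ) (L s t : ℕ) (AD BD : List (List ℝ≥0∞)) (v : List ℝ)
    (hA : ∀ a ∈ AD, a.length ≤ t) (hB : ∀ b ∈ BD, b.length ≤ t) (hst : s ≤ t)
    (hAL : AD.length ≤ 2 ^ L) (hBL : BD.length ≤ 2 ^ L) (ξ : Array ℝ) (k : ℕ) (hk : k ≤ s) :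
    (crossLoop ε s AD BD v k ξ).time ≤
      k * ((6 * L + 16) * (t + 1) * (L + 2) ^ t * (AD.length + BD.length) + t + 4) + 1 := by
  induction k with
  | zero => simp [crossLoop]
  | succ k ih =>
    have h0 := ih (by omega)
    have h1 := mkQueries_time t k 0 AD hA
    have h2 := mkPoints_time t k BD v hB
    have h3 := crossRec_time ε L (flagsOf k s) (mkQueries k 0 AD).val (mkPoints k BD v).val
      (crossLoop ε s AD BD v k ξ).val ((length_mkQueries _ _ _).trans hAL)
      ((length_mkPoints _ _ _).trans hBL)
    have h4 : (6 * L + 10) * ((flagsOf k s).length + 1) * (L + 2) ^ (flagsOf k s).length *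
        ((mkQueries k 0 AD).val.length + (mkPoints k BD v).val.length) ≤
        (6 * L + 10) * (t + 1) * (L + 2) ^ t * (AD.length + BD.length) := by
      rw [length_flagsOf (by omega)]
      have := length_mkQueries k 0 AD
      have := length_mkPoints k BD v
      gcongr <;> omega
    have hpow : 1 ≤ (L + 2) ^ t := Nat.one_le_pow _ _ (by omega)
    have h5 : (3 * t + 6) * AD.length + (3 * t + 6) * BD.length ≤
        6 * (t + 1) * (L + 2) ^ t * (AD.length + BD.length) := by
      rw [← mul_add]
      refine Nat.mul_le_mul_right _ ?_
      calc 3 * t + 6 ≤ 6 * (t + 1) * 1 := by omega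
        _ ≤ _ := Nat.mul_le_mul_left _ hpow
    have h6 : (6 * L + 16) * (t + 1) * (L + 2) ^ t * (AD.length + BD.length) =
        (6 * L + 10) * (t + 1) * (L + 2) ^ t * (AD.length + BD.length) +
        6 * (t + 1) * (L + 2) ^ t * (AD.length + BD.length) := by ring
    have h7 : (mkFlags k s).time = s + 1 := rfl
    simp only [crossLoop, time_bind, mkFlags_val, add_mul k 1, one_mul]
    omega

theorem crossHalf_time (ε : ℝ) (L s : ℕ) (AD BD : List (List ℝ≥0∞)) (v : List ℝ)
    (hA : ∀ a ∈ AD, a.length ≤ s) (hB : ∀ b ∈ BD, b.length ≤ s)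
    (hAL : AD.length ≤ 2 ^ L) (hBL : BD.length ≤ 2 ^ L) :
    (crossHalf ε s AD BD v).time ≤
      s * ((6 * L + 16) * (s + 1) * (L + 2) ^ s * (AD.length + BD.length) + s + 4) +
        3 * AD.length + 4 := by
  have := crossLoop_time ε L s s AD BD v hA hB le_rfl hAL hBL
    (Array.replicate AD.length 0) s le_rfl
  simp only [crossHalf, time_bind, len_time, len_val, zeros, time_bulk, val_bulk]
  omega

/-! ### Shortest paths, torsos and separations -/

namespace WGraph

variable {n : ℕ} (G : WGraph n)

theorem walkLength_nil (u : Fin n) : G.walkLength (SimpleGraph.Walk.nil : G.graph.Walk u u) = 0 := by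
  simp [walkLength]

theorem walkLength_cons {u v w : Fin n} (h : G.graph.Adj u v) (p : G.graph.Walk v w) :
    G.walkLength (SimpleGraph.Walk.cons h p) = G.weight u v + G.walkLength p := by
  simp [walkLength]

theorem walkLength_append {u v w : Fin n} (p : G.graph.Walk u v) (q : G.graph.Walk v w) :
    G.walkLength (p.append q) = G.walkLength p + G.walkLength q := by
  simp [walkLength]

theorem dist_le_walkLength {u v : Fin n} (p : G.graph.Walk u v) :
    G.dist u v ≤ (G.walkLength p : ℝ≥0∞) :=
  iInf_le (fun p : G.graph.Walk u v => (G.walkLength p : ℝ≥0∞)) p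

theorem dist_self (u : Fin n) : G.dist u u = 0 := by
  have := G.dist_le_walkLength (SimpleGraph.Walk.nil : G.graph.Walk u u)
  rwa [walkLength_nil, ENNReal.coe_zero, nonpos_iff_eq_zero] at this

theorem dist_le_weight {u v : Fin n} (h : G.graph.Adj u v) : G.dist u v ≤ G.weight u v := by
  simpa [walkLength_cons, walkLength_nil] using
    G.dist_le_walkLength (SimpleGraph.Walk.cons h SimpleGraph.Walk.nil)

theorem dist_triangle (u v w : Fin n) : G.dist u w ≤ G.dist u v + G.dist v w := by
  rw [dist, dist, dist, ENNReal.iInf_add]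
  refine le_iInf fun p => ?_
  rw [ENNReal.add_iInf]
  refine le_iInf fun q => ?_
  have := G.dist_le_walkLength (p.append q)
  rwa [walkLength_append, ENNReal.coe_add] at this

section Torso

variable {S Y : Finset (Fin n)}

theorem dist_le_torso_weight {i j : Fin Y.card} (h : (G.torso S Y).graph.Adj i j) :
    G.dist (Y.orderEmbOfFin rfl i) (Y.orderEmbOfFin rfl j) ≤ (G.torso S Y).weight i j := by
  have h2 := h.2
  simp only [torso]
  split_ifs at h2 ⊢ with hS
  · rw [ENNReal.coe_toNNReal h2]
  · exact G.dist_le_weight h2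

/-- Every edge of the torso is at least as long as the distance of its ends in `G`; summing along a
walk by the triangle inequality needs nothing about how `S` lies in `Y`. -/
theorem dist_le_torso_dist (i j : Fin Y.card) :
    G.dist (Y.orderEmbOfFin rfl i) (Y.orderEmbOfFin rfl j) ≤ (G.torso S Y).dist i j := by
  refine le_iInf fun p => ?_
  induction p with
  | nil => rw [dist_self]; exact zero_le
  | cons h p ih =>
    rw [walkLength_cons, ENNReal.coe_add]
    exact (G.dist_triangle _ _ _).trans (add_le_add (G.dist_le_torso_weight h) ih)

theorem torso_dist_le_of_mem {i j : Fin Y.card} (hi : Y.orderEmbOfFin rfl i ∈ S)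
    (hj : Y.orderEmbOfFin rfl j ∈ S) :
    (G.torso S Y).dist i j ≤ G.dist (Y.orderEmbOfFin rfl i) (Y.orderEmbOfFin rfl j) := by
  rcases eq_or_ne i j with rfl | hne
  · rw [dist_self]; exact zero_le
  rcases eq_or_ne (G.dist (Y.orderEmbOfFin rfl i) (Y.orderEmbOfFin rfl j)) ⊤ with h | h
  · rw [h]; exact le_top
  have hadj : (G.torso S Y).graph.Adj i j := by
    refine ⟨hne, ?_⟩
    rw [if_pos ⟨hi, hj⟩]
    exact h
  refine ((G.torso S Y).dist_le_weight hadj).trans ?_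
  simp only [torso]
  rw [if_pos ⟨hi, hj⟩, ENNReal.coe_toNNReal h]

theorem torso_dist_le_of_adj {i j : Fin Y.card}
    (h : G.graph.Adj (Y.orderEmbOfFin rfl i) (Y.orderEmbOfFin rfl j)) :
    (G.torso S Y).dist i j ≤ G.weight (Y.orderEmbOfFin rfl i) (Y.orderEmbOfFin rfl j) := by
  by_cases hS : Y.orderEmbOfFin rfl i ∈ S ∧ Y.orderEmbOfFin rfl j ∈ S
  · exact (G.torso_dist_le_of_mem hS.1 hS.2).trans (G.dist_le_weight h)
  have hadj : (G.torso S Y).graph.Adj i j := by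
    refine ⟨fun e => h.ne (by rw [e]), ?_⟩
    rw [if_neg hS]
    exact h
  refine ((G.torso S Y).dist_le_weight hadj).trans ?_
  simp only [torso]
  rw [if_neg hS]

theorem exists_orderEmbOfFin {u : Fin n} (h : u ∈ Y) : ∃ i, Y.orderEmbOfFin rfl i = u := by
  have : u ∈ Set.range (Y.orderEmbOfFin rfl) := by rw [Finset.range_orderEmbOfFin]; exact h
  exact this

/-- A walk that ends in `Y` is at least as long as a way that leaves `Y` only through `S`. -/
theorem torso_walk_bound (hX : ∀ u ∉ Y, ∀ w ∈ Y, G.graph.Adj u w → w ∈ S)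
    {u v : Fin n} (p : G.graph.Walk u v) (j : Fin Y.card) (hj : Y.orderEmbOfFin rfl j = v) :
    (∀ i, Y.orderEmbOfFin rfl i = u → (G.torso S Y).dist i j ≤ G.walkLength p) ∧
    (u ∉ Y → ∃ k, Y.orderEmbOfFin rfl k ∈ S ∧
      G.dist u (Y.orderEmbOfFin rfl k) + (G.torso S Y).dist k j ≤ G.walkLength p) := by
  induction p with
  | nil =>
    constructor
    · intro i hi
      rw [← hj] at hi
      rw [(Y.orderEmbOfFin rfl).injective hi, dist_self]
      exact zero_le
    · intro hu
      exact absurd (hj ▸ Y.orderEmbOfFin_mem rfl j) hu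
  | @cons u w v h p ih =>
    -- The two claims are proved together: the second keeps track of an excursion outside `Y` until
    -- its return through `S`, and the first closes it.
    obtain ⟨ih1, ih2⟩ := ih hj
    rw [walkLength_cons, ENNReal.coe_add]
    by_cases hw : w ∈ Y
    · obtain ⟨l, hl⟩ := exists_orderEmbOfFin hw
      constructor
      · intro i hi
        refine ((G.torso S Y).dist_triangle i l j).trans (add_le_add ?_ (ih1 l hl))
        have := G.torso_dist_le_of_adj (S := S) (i := i) (j := l) (by rw [hi, hl]; exact h)
        rwa [hi, hl] at this
      · intro hu
        refine ⟨l, by rw [hl]; exact hX u hu w hw h, add_le_add ?_ (ih1 l hl)⟩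
        rw [hl]
        exact G.dist_le_weight h
    · obtain ⟨k, hk, hk'⟩ := ih2 hw
      have hd : G.dist u (Y.orderEmbOfFin rfl k) + (G.torso S Y).dist k j ≤
          G.weight u w + G.walkLength p := by
        refine le_trans (add_le_add_left (G.dist_triangle u w _) _) ?_
        rw [add_assoc]
        exact add_le_add (G.dist_le_weight h) hk'
      constructor
      · intro i hi
        -- The walk leaves `Y` along this edge; read backwards, the edge enters `Y`, so `u` lies in
        -- `S`, and the excursion from `u` to `k` is replaced by the torso distance between two
        -- vertices of `S`.
        have hu : u ∈ S := hX w hw u (hi ▸ Y.orderEmbOfFin_mem rfl i) h.symm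
        refine ((G.torso S Y).dist_triangle i k j).trans (le_trans (add_le_add_left ?_ _) hd)
        rw [← hi]
        exact G.torso_dist_le_of_mem (by rw [hi]; exact hu) hk
      · exact fun _ => ⟨k, hk, hd⟩

/-- The hypothesis says that `Y` is entered from outside only at `S`; by symmetry of adjacency it is
left only there as well. -/
theorem torso_dist (hX : ∀ u ∉ Y, ∀ w ∈ Y, G.graph.Adj u w → w ∈ S)
    (i j : Fin Y.card) :
    (G.torso S Y).dist i j = G.dist (Y.orderEmbOfFin rfl i) (Y.orderEmbOfFin rfl j) :=
  le_antisymm (le_iInf fun p => (G.torso_walk_bound hX p j rfl).1 i rfl)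
    (G.dist_le_torso_dist i j)

theorem exists_separator_vertex (hX : ∀ u ∉ Y, ∀ w ∈ Y, G.graph.Adj u w → w ∈ S)
    {u v : Fin n} (hu : u ∉ Y) (hv : v ∈ Y) (p : G.graph.Walk u v) :
    ∃ k ∈ S, G.dist u k + G.dist k v ≤ G.walkLength p := by
  obtain ⟨j, rfl⟩ := exists_orderEmbOfFin hv
  obtain ⟨k, hk, h⟩ := (G.torso_walk_bound hX p j rfl).2 hu
  exact ⟨_, hk, le_trans (add_le_add_right (G.dist_le_torso_dist k j) _) h⟩

end Torso

namespace IsSeparation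

variable {G} {A S B : Finset (Fin n)}

theorem symm (h : G.IsSeparation A S B) : G.IsSeparation B S A where
  disjoint_AS := h.disjoint_SB.symm
  disjoint_AB := h.disjoint_AB.symm
  disjoint_SB := h.disjoint_AS.symm
  cover := by rw [← h.cover, Finset.union_right_comm, Finset.union_comm B A,
    Finset.union_right_comm]
  no_edge := fun a ha b hb hab => h.no_edge b hb a ha hab.symm

theorem mem_or (h : G.IsSeparation A S B) (u : Fin n) : u ∈ A ∨ u ∈ S ∨ u ∈ B := by
  have : u ∈ A ∪ S ∪ B := h.cover ▸ Finset.mem_univ u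
  simpa [or_assoc] using this

theorem adj_mem (h : G.IsSeparation A S B) :
    ∀ u ∉ A ∪ S, ∀ w ∈ A ∪ S, G.graph.Adj u w → w ∈ S := by
  intro u hu w hw hadj
  simp only [Finset.mem_union, not_or] at hu hw
  rcases hw with hw | hw
  · rcases h.mem_or u with h' | h' | h'
    · exact absurd h' hu.1
    · exact absurd h' hu.2
    · exact absurd hadj.symm (h.no_edge w hw u h')
  · exact hw

theorem torso_kernel (h : G.IsSeparation A S B) (ε : ℝ) (i j : Fin (A ∪ S).card) :
    (G.torso S (A ∪ S)).kernel ε i j =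
      G.kernel ε ((A ∪ S).orderEmbOfFin rfl i) ((A ∪ S).orderEmbOfFin rfl j) := by
  simp only [kernel, Matrix.of_apply, G.torso_dist h.adj_mem]

theorem exists_mem_separator (h : G.IsSeparation A S B) {u v : Fin n} (hu : u ∈ A) (hv : v ∈ B)
    (p : G.graph.Walk u v) : ∃ k ∈ S, G.dist u k + G.dist v k ≤ G.walkLength p := by
  obtain ⟨k, hk, hk'⟩ := G.exists_separator_vertex h.symm.adj_mem
    (u := u) (v := v)
    (by
      rw [Finset.mem_union, not_or]
      exact ⟨Finset.disjoint_left.1 h.disjoint_AB hu, Finset.disjoint_left.1 h.disjoint_AS hu⟩)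
    (Finset.mem_union_left _ hv) p
  exact ⟨k, hk, by rwa [G.dist_symm v k]⟩

/-- A walk from `A` to `B` passes through some vertex of `S`, which gives one inequality; the other
is the triangle inequality. The default `⊤` is never read, because `l` ranges over valid positions.
-/
theorem iInf_dist {S : List (Fin n)} (h : G.IsSeparation A S.toFinset B) {u v : Fin n}
    (hu : u ∈ A) (hv : v ∈ B) :
    ⨅ l : Fin S.length, ((S.map fun k => G.dist u k).getD l ⊤ +
      (S.map fun k => G.dist v k).getD l ⊤) = G.dist u v := by
  have e : ∀ l : Fin S.length, (S.map fun k => G.dist u k).getD l ⊤ +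
      (S.map fun k => G.dist v k).getD l ⊤ = G.dist u S[l] + G.dist v S[l] := by
    intro l; simp
  simp only [e]
  apply le_antisymm
  · refine le_iInf fun p => ?_
    obtain ⟨k, hk, hk'⟩ := h.exists_mem_separator hu hv p
    obtain ⟨l, hl, rfl⟩ := List.mem_iff_getElem.1 (List.mem_toFinset.1 hk)
    exact (iInf_le _ (⟨l, hl⟩ : Fin S.length)).trans hk'
  · refine le_iInf fun l => ?_
    rw [G.dist_symm v]
    exact G.dist_triangle _ _ _

end IsSeparation

/-! ### Brute force -/

theorem adjEntry_symm (i j : Fin n) : G.adjEntry i j = G.adjEntry j i := by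
  rw [adjEntry, adjEntry, G.weight_symm i j]
  by_cases h : G.graph.Adj i j
  · simp [h, h.symm, eq_comm]
  · have h' : ¬ G.graph.Adj j i := fun h' => h h'.symm
    simp [h, h', eq_comm]

theorem dist_le_adjEntry (i j : Fin n) : G.dist i j ≤ G.adjEntry i j := by
  rw [adjEntry]
  split_ifs with h h'
  · subst h; rw [dist_self]
  · exact G.dist_le_weight h'
  · exact le_top

theorem adjRows_eq : G.adjRows =
    (List.finRange n).map fun i => (List.finRange n).map fun j => G.adjEntry i j := by
  simp only [adjRows, List.ofFn_eq_map]

/-- Cutting out cycles gives a path that uses a subset of the original darts, none repeated; since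
weights are nonnegative, the length does not grow. -/
theorem exists_short_walk {u v : Fin n} (p : G.graph.Walk u v) :
    ∃ q : G.graph.Walk u v, q.length < n ∧ G.walkLength q ≤ G.walkLength p := by
  refine ⟨p.bypass, ?_, ?_⟩
  · simpa using (p.bypass_isPath).length_lt
  · have hs := p.bypass.darts.subperm_of_subset
      (SimpleGraph.Walk.darts_nodup_of_support_nodup p.bypass_isPath.support_nodup)
      p.darts_bypass_subset_darts
    obtain ⟨l, hl, hl'⟩ := hs
    rw [walkLength, walkLength, ← (hl.map _).sum_eq]
    exact (hl'.map _).sum_le_sum fun _ _ => zero_le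

end WGraph

theorem minPlus_le {ι : Type} (l : List ι) (f g : ι → ℝ≥0∞) (j : ι) (hj : j ∈ l) :
    (minPlus (l.map f) (l.map g)).val ≤ f j + g j := by
  induction l with
  | nil => simp at hj
  | cons i t ih =>
    simp only [List.map_cons, minPlus, val_bind, val_op]
    rcases List.mem_cons.1 hj with rfl | hj
    · exact min_le_left _ _
    · exact (min_le_right _ _).trans (ih hj)

theorem le_minPlus {ι : Type} (l : List ι) (f g : ι → ℝ≥0∞) (c : ℝ≥0∞)
    (h : ∀ j ∈ l, c ≤ f j + g j) : c ≤ (minPlus (l.map f) (l.map g)).val := by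
  induction l with
  | nil => exact le_top
  | cons i t ih =>
    simp only [List.map_cons, minPlus, val_bind, val_op]
    exact le_min (h i (by simp)) (ih fun j hj => h j (by simp [hj]))

theorem relax_map {ι κ : Type} (l : List ι) (k : List κ) (f : ι → ℝ≥0∞) (W : κ → ι → ℝ≥0∞) :
    (relax (l.map f) (k.map fun j => l.map (W j))).val =
      k.map fun j => (minPlus (l.map f) (l.map (W j))).val := by
  induction k with
  | nil => rfl
  | cons i t ih => simp [relax, ih]

theorem allDist_map {κ : Type} (W : List (List ℝ≥0∞)) (r : ℕ) (k : List κ)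
    (f : κ → List ℝ≥0∞) :
    (allDist W r (k.map f)).val = k.map fun i => (relaxRounds W r (f i)).val := by
  induction k with
  | nil => rfl
  | cons i t ih => simp [allDist, ih]

/-- After `k` rounds, walks with at most `m + k` edges are taken into account. -/
theorem relaxRounds_spec {n : ℕ} (G : WGraph n) (i : Fin n) (k m : ℕ) (f : Fin n → ℝ≥0∞)
    (hf : ∀ j, G.dist j i ≤ f j)
    (hf' : ∀ (j : Fin n) (p : G.graph.Walk j i), p.length ≤ m → f j ≤ G.walkLength p) :
    ∃ g : Fin n → ℝ≥0∞, (relaxRounds G.adjRows k ((List.finRange n).map f)).val =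
        (List.finRange n).map g ∧ (∀ j, G.dist j i ≤ g j) ∧
      ∀ (j : Fin n) (p : G.graph.Walk j i), p.length ≤ m + k → g j ≤ G.walkLength p := by
  induction k generalizing m f with
  | zero => exact ⟨f, rfl, hf, hf'⟩
  | succ k ih =>
    simp only [relaxRounds, val_bind]
    rw [G.adjRows_eq, relax_map, ← G.adjRows_eq]
    set f₁ : Fin n → ℝ≥0∞ := fun j => (minPlus ((List.finRange n).map f)
      ((List.finRange n).map (G.adjEntry j))).val with hf₁
    obtain ⟨g, h1, h2, h3⟩ := ih (m + 1) f₁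
      (by
        intro j
        refine le_minPlus _ _ _ _ fun l _ => (G.dist_triangle j l i).trans ?_
        rw [add_comm]
        exact add_le_add (hf l) (G.dist_le_adjEntry j l))
      (by
        intro j p hp
        cases p with
        -- The zero diagonal of the adjacency matrix lets a round keep an old value, so shorter
        -- walks are not lost.
        | nil =>
          refine (minPlus_le _ _ _ i (List.mem_finRange i)).trans ?_
          have := hf' i SimpleGraph.Walk.nil (by simp)
          simpa [WGraph.adjEntry] using this
        | @cons _ l _ h p =>
          refine (minPlus_le _ _ _ l (List.mem_finRange l)).trans ?_
          rw [WGraph.walkLength_cons, ENNReal.coe_add, add_comm]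
          refine add_le_add (le_of_eq ?_) (hf' l p (by simpa using hp))
          rw [WGraph.adjEntry, if_neg h.ne, if_pos h])
    exact ⟨g, h1, h2, fun j p hp => h3 j p (by omega)⟩

theorem relaxRounds_adjRows {n : ℕ} (G : WGraph n) (i : Fin n) :
    (relaxRounds G.adjRows n ((List.finRange n).map (G.adjEntry i))).val =
      (List.finRange n).map (G.dist i) := by
  -- Starting from walks with no edges, `n` rounds cover all walks with at most `n` edges, more than
  -- a path needs.
  obtain ⟨g, h1, h2, h3⟩ := relaxRounds_spec G i n 0 (G.adjEntry i)
    (fun j => by rw [G.adjEntry_symm]; exact G.dist_le_adjEntry j i)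
    (fun j p hp => by
      obtain rfl := SimpleGraph.Walk.eq_of_length_eq_zero (Nat.le_zero.1 hp)
      simp [WGraph.adjEntry])
  rw [h1]
  congr 1
  funext j
  rw [G.dist_symm i j]
  refine le_antisymm (le_iInf fun p => ?_) (h2 j)
  obtain ⟨q, hq, hq'⟩ := G.exists_short_walk p
  exact (h3 j q (by omega)).trans (by exact_mod_cast hq')

theorem kernel_mulVec {n : ℕ} (G : WGraph n) (ε : ℝ) (x : Fin n → ℝ) (i : Fin n) :
    (G.kernel ε *ᵥ x) i = ∑ j, fEps ε (G.dist i j) * x j := rfl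

theorem bruteForce_val {n : ℕ} (G : WGraph n) (ε : ℝ) (x : Fin n → ℝ) :
    (bruteForce ε G.adjRows (Array.ofFn x)).val = Array.ofFn (G.kernel ε *ᵥ x) := by
  have hl : G.adjRows.length = n := by simp [WGraph.adjRows]
  simp only [bruteForce, val_bind, val_bulk, len_val, hl]
  have h1 : (allDist G.adjRows n G.adjRows).val =
      (List.finRange n).map fun i => (List.finRange n).map (G.dist i) := by
    conv_lhs => rw [G.adjRows_eq]
    rw [allDist_map, ← G.adjRows_eq]
    exact List.map_congr_left fun i _ => relaxRounds_adjRows G i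
  rw [h1, Array.toList_ofFn, List.ofFn_eq_map, matVecF_map, ← List.ofFn_eq_map]
  rw [← Array.toList_inj]
  simp only [Array.toList_ofFn]
  congr 1

theorem minPlus_time (d e : List ℝ≥0∞) : (minPlus d e).time ≤ 2 * e.length + 1 := by
  induction d generalizing e with
  | nil => simp [minPlus]
  | cons x t ih =>
    cases e with
    | nil => simp [minPlus]
    | cons y u => have := ih u; simp [minPlus]; omega

theorem relax_time (d : List ℝ≥0∞) (W : List (List ℝ≥0∞)) (m : ℕ)
    (hW : ∀ r ∈ W, r.length ≤ m) : (relax d W).time ≤ (2 * m + 2) * W.length + 1 := by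
  induction W with
  | nil => simp [relax]
  | cons r t ih =>
    have h1 := ih fun r hr => hW r (List.mem_cons_of_mem _ hr)
    have h2 := minPlus_time d r
    have h3 := hW r List.mem_cons_self
    simp only [relax, time_bind, time_op, List.length_cons, mul_add, mul_one]
    omega

theorem relaxRounds_time (W : List (List ℝ≥0∞)) (m k : ℕ) (d : List ℝ≥0∞)
    (hW : ∀ r ∈ W, r.length ≤ m) :
    (relaxRounds W k d).time ≤ k * ((2 * m + 2) * W.length + 1) + 1 := by
  induction k generalizing d with
  | zero => simp [relaxRounds]
  | succ k ih =>
    have h1 := ih (relax d W).val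
    have h2 := relax_time d W m hW
    simp only [relaxRounds, time_bind, add_mul k 1, one_mul]
    omega

theorem allDist_time (W V : List (List ℝ≥0∞)) (m k : ℕ) (hW : ∀ r ∈ W, r.length ≤ m) :
    (allDist W k V).time ≤ V.length * (k * ((2 * m + 2) * W.length + 1) + 2) + 1 := by
  induction V with
  | nil => simp [allDist]
  | cons r t ih =>
    have h2 := relaxRounds_time W m k r hW
    simp only [allDist, time_bind, time_op, List.length_cons, add_one_mul t.length]
    omega

theorem bruteForce_time {n : ℕ} (G : WGraph n) (ε : ℝ) (x : Fin n → ℝ) (hn : 1 ≤ n) :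
    (bruteForce ε G.adjRows (Array.ofFn x)).time ≤ 20 * n ^ 4 := by
  have hl : G.adjRows.length = n := by simp [WGraph.adjRows]
  have h1 := allDist_time G.adjRows G.adjRows n n (by simp [WGraph.adjRows])
  have h2 := matVecF_time ε (allDist G.adjRows n G.adjRows).val (List.ofFn x)
  have h3 : (allDist G.adjRows n G.adjRows).val.length = n := by
    conv_lhs => rw [G.adjRows_eq]
    rw [allDist_map]
    simp
  rw [hl] at h1
  rw [h3, List.length_ofFn] at h2
  simp only [bruteForce, time_bind, val_bulk, time_bulk, len_val, len_time, hl, Array.size_ofFn,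
    Array.toList_ofFn]
  have e2 : n ≤ n ^ 4 := Nat.le_self_pow (by norm_num) n
  have e3 : n ^ 2 ≤ n ^ 4 := Nat.pow_le_pow_right hn (by norm_num)
  have e4 : n ^ 3 ≤ n ^ 4 := Nat.pow_le_pow_right hn (by norm_num)
  have e5 : n * (n * ((2 * n + 2) * n + 1) + 2) = 2 * n ^ 4 + 2 * n ^ 3 + n ^ 2 + 2 * n := by ring
  have e6 : (3 * n + 2) * n = 3 * n ^ 2 + 2 * n := by ring
  omega

/-! ### Recursive calls and exactness -/

/-- A repetition-free list has only one increasing arrangement, so sorting the ids reproduces the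
renaming used by `torso`. This is what matches positions in the child's vector with vertices. -/
theorem msort_ids {n : ℕ} (A S : List (Fin n)) (hAS : (A ++ S).Nodup) :
    (msort id (A.map Fin.val ++ S.map Fin.val)).val =
      (List.finRange (A.toFinset ∪ S.toFinset).card).map
        fun k => ((A.toFinset ∪ S.toFinset).orderEmbOfFin rfl k : ℕ) := by
  set Y := A.toFinset ∪ S.toFinset
  have hinj : Function.Injective fun k => (Y.orderEmbOfFin rfl k : ℕ) :=
    Fin.val_injective.comp (Y.orderEmbOfFin rfl).injective
  refine List.Perm.eq_of_pairwise (le := (· ≤ ·)) (fun a b _ _ h1 h2 => le_antisymm h1 h2)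
    (msort_sorted id _) ?_ ((msort_perm id _).trans ?_)
  · refine List.Pairwise.map _ ?_ (List.pairwise_lt_finRange _)
    intro a b hab
    exact (Y.orderEmbOfFin rfl).monotone hab.le
  · rw [← List.map_append, List.perm_ext_iff_of_nodup (hAS.map Fin.val_injective)
      ((List.nodup_finRange _).map hinj)]
    intro a
    simp only [List.mem_map, List.mem_finRange, true_and]
    have hY : ∀ j, j ∈ A ++ S ↔ j ∈ Y := by simp [Y]
    constructor
    · rintro ⟨j, hj, rfl⟩
      obtain ⟨k, rfl⟩ := WGraph.exists_orderEmbOfFin ((hY j).1 hj)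
      exact ⟨k, rfl⟩
    · rintro ⟨k, rfl⟩
      exact ⟨_, (hY _).2 (Y.orderEmbOfFin_mem rfl k), rfl⟩

section CallChild

variable {n : ℕ} (A S : List (Fin n))
  (child : Array ℝ → Timed (Array ℝ)) (x : Fin n → ℝ)

theorem gather_sorted (hAS : (A ++ S).Nodup) :
    (gather (Array.ofFn x) (msort id (A.map Fin.val ++ S.map Fin.val)).val).val.toArray =
      Array.ofFn fun k => x ((A.toFinset ∪ S.toFinset).orderEmbOfFin rfl k) := by
  rw [msort_ids A S hAS, gather_val, List.map_map, ← Array.toList_inj, Array.toList_ofFn,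
    List.ofFn_eq_map]
  exact List.map_congr_left fun k _ => getD_ofFn _ _

theorem callChild_val (hAS : (A ++ S).Nodup) (y y' : Fin n → ℝ) (z : Fin (A.toFinset ∪ S.toFinset).card → ℝ)
    (hz : (child (Array.ofFn fun k => x ((A.toFinset ∪ S.toFinset).orderEmbOfFin rfl k))).val =
      Array.ofFn z)
    (hy : ∀ k, y' ((A.toFinset ∪ S.toFinset).orderEmbOfFin rfl k) =
      y ((A.toFinset ∪ S.toFinset).orderEmbOfFin rfl k) + z k)
    (hy' : ∀ j ∉ A.toFinset ∪ S.toFinset, y' j = y j) :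
    (callChild child (Array.ofFn x) (Array.ofFn y) (A.map Fin.val) (S.map Fin.val)).val =
      Array.ofFn y' := by
  simp only [callChild, val_bind, val_bulk, concat_val, gather_sorted A S x hAS, hz,
    Array.toList_ofFn]
  rw [msort_ids A S hAS, List.ofFn_eq_map]
  apply scatter_ofFn
  · exact (List.nodup_finRange _).map ((A.toFinset ∪ S.toFinset).orderEmbOfFin rfl).injective
  · exact fun k _ => hy k
  · intro j hj
    apply hy'
    intro hj'
    obtain ⟨k, rfl⟩ := WGraph.exists_orderEmbOfFin hj'
    exact hj (List.mem_map_of_mem (List.mem_finRange k))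

theorem callChild_time (hAS : (A ++ S).Nodup) (y : Array ℝ) (L : ℕ) (hL : A.length + S.length ≤ 2 ^ L) :
    (callChild child (Array.ofFn x) y (A.map Fin.val) (S.map Fin.val)).time ≤
      (6 * L + 10) * (A.length + S.length) + 8 +
        (child (Array.ofFn fun k => x ((A.toFinset ∪ S.toFinset).orderEmbOfFin rfl k))).time := by
  have h1 := msort_time (id : ℕ → ℕ) L (A.map Fin.val ++ S.map Fin.val) (by simpa using hL)
  have h2 := gather_time (Array.ofFn x) (msort id (A.map Fin.val ++ S.map Fin.val)).val
  have h3 : (msort id (A.map Fin.val ++ S.map Fin.val)).val.length = A.length + S.length := by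
    rw [length_msort_val]; simp
  have h4 := scatter_time (· + ·) y (msort id (A.map Fin.val ++ S.map Fin.val)).val
    (child (Array.ofFn fun k => x ((A.toFinset ∪ S.toFinset).orderEmbOfFin rfl k))).val.toList
  have h5 : (gather (Array.ofFn x) (msort id (A.map Fin.val ++ S.map Fin.val)).val).val.length =
      A.length + S.length := by
    rw [gather_val, List.length_map, h3]
  simp only [callChild, time_bind, val_bulk, time_bulk, concat_val, concat_time,
    gather_sorted A S x hAS, len_val, len_time, h5, List.length_map]
  rw [h3] at h2 h4
  rw [List.length_append, List.length_map, List.length_map] at h1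
  have h6 : (6 * L + 10) * (A.length + S.length) =
    (6 * L + 1) * (A.length + S.length) + 9 * (A.length + S.length) := by ring
  omega

end CallChild

/-- A sum over a list without repetitions of vertices. -/
theorem sum_map_eq {n : ℕ} {l : List (Fin n)} (hl : l.Nodup) (f : Fin n → ℝ) :
    (l.map f).sum = ∑ j ∈ l.toFinset, f j := (List.sum_toFinset f hl).symm

theorem crossHalf_separation {n : ℕ} {G : WGraph n} {A S B : List (Fin n)} (hB : B.Nodup)
    (h : G.IsSeparation A.toFinset S.toFinset B.toFinset) (ε : ℝ) (x : Fin n → ℝ) :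
    (crossHalf ε S.length (A.map fun i => S.map fun j => G.dist i j)
      (B.map fun i => S.map fun j => G.dist i j) (B.map x)).val =
      A.map fun i => ∑ j ∈ B.toFinset, fEps ε (G.dist i j) * x j := by
  rw [crossHalf_val ε S.length A B (fun i => S.map fun j => G.dist i j)
    (fun i => S.map fun j => G.dist i j) x (by simp) (by simp)]
  apply List.map_congr_left
  intro i hi
  rw [← sum_map_eq hB]
  congr 1
  apply List.map_congr_left
  intro j hj
  rw [h.iInf_dist (List.mem_toFinset.2 hi) (List.mem_toFinset.2 hj)]

/-- The child's product, reindexed by vertices of `G`: its kernel is a block of the kernel of `G`,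
because distances are preserved. -/
theorem torso_mulVec {n : ℕ} {G : WGraph n} {A S B : Finset (Fin n)}
    (h : G.IsSeparation A S B) (ε : ℝ) (x : Fin n → ℝ) (k : Fin (A ∪ S).card) :
    ((G.torso S (A ∪ S)).kernel ε *ᵥ fun l => x ((A ∪ S).orderEmbOfFin rfl l)) k =
      ∑ j ∈ A ∪ S, fEps ε (G.dist ((A ∪ S).orderEmbOfFin rfl k) j) * x j := by
  have hsum : ∀ f : Fin n → ℝ, ∑ j ∈ A ∪ S, f j = ∑ l, f ((A ∪ S).orderEmbOfFin rfl l) := by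
    intro f
    conv_lhs => rw [← Finset.map_orderEmbOfFin_univ (A ∪ S) rfl, Finset.sum_map]
    rfl
  rw [Matrix.mulVec, dotProduct, hsum]
  apply Finset.sum_congr rfl
  intro l _
  rw [h.torso_kernel]
  rfl

theorem nodup_append_of_disjoint {α : Type} [DecidableEq α] {A S : List α} (hA : A.Nodup) (hS : S.Nodup)
    (h : Disjoint A.toFinset S.toFinset) : (A ++ S).Nodup :=
  hA.append hS (List.disjoint_toFinset_iff_disjoint.1 h)

theorem gather_ofFn {n : ℕ} (x : Fin n → ℝ) (l : List (Fin n)) :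
    (gather (Array.ofFn x) (l.map Fin.val)).val = l.map x := by
  rw [gather_val, List.map_map]
  exact List.map_congr_left fun k _ => getD_ofFn _ _

theorem integrate_val (T : SGFI) {n : ℕ} (G : WGraph n) (hT : T.Represents G) (ε : ℝ)
    (x : Fin n → ℝ) : (T.integrate ε (Array.ofFn x)).val = Array.ofFn (G.kernel ε *ᵥ x) := by
  induction T generalizing n with
  | leaf W =>
    obtain rfl : W = G.adjRows := hT
    exact bruteForce_val G ε x
  | node aIds sIds bIds SD AD BD l r ihl ihr =>
    obtain ⟨A, S, B, hA, hS, hB, hsep, rfl, rfl, rfl, rfl, rfl, rfl, hl, hr⟩ := hT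
    set K : Fin n → Fin n → ℝ := fun i j => fEps ε (G.dist i j) * x j with hK
    have hAS := hsep.disjoint_AS
    have hAB := hsep.disjoint_AB
    have hBS := hsep.disjoint_SB.symm
    rw [Finset.disjoint_left] at hAS hAB hBS
    -- The functions `y₁` to `y₄` are the states of the output vector after the two cross products
    -- and the two recursive calls.
    set y₁ : Fin n → ℝ := fun i => if i ∈ A.toFinset then ∑ j ∈ B.toFinset, K i j else 0 with h₁
    set y₂ : Fin n → ℝ := fun i => y₁ i + if i ∈ B.toFinset then ∑ j ∈ A.toFinset, K i j else 0
      with h₂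
    set y₃ : Fin n → ℝ := fun i => y₂ i + if i ∈ A.toFinset ∪ S.toFinset then
      ∑ j ∈ A.toFinset ∪ S.toFinset, K i j else 0 with h₃
    set y₄ : Fin n → ℝ := fun i => y₃ i + if i ∈ B.toFinset ∪ S.toFinset then
      ∑ j ∈ B.toFinset ∪ S.toFinset, K i j else 0 with h₄
    have hz : (zeros (Array.ofFn x).size).val = Array.ofFn fun _ : Fin n => (0 : ℝ) := by
      apply Array.ext <;> simp [zeros]
    have e₁ : (scatter (· + ·) (Array.ofFn fun _ : Fin n => (0 : ℝ)) (A.map Fin.val)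
        (A.map fun i => ∑ j ∈ B.toFinset, K i j)).val = Array.ofFn y₁ := by
      refine scatter_ofFn _ _ A (fun i => i) _ _ (by simpa using hA) ?_ ?_
      · intro i hi; simp [h₁, hi]
      · intro j hj
        simp only [List.map_id'] at hj
        simp [h₁, hj]
    have e₂ : (scatter (· + ·) (Array.ofFn y₁) (B.map Fin.val)
        (B.map fun i => ∑ j ∈ A.toFinset, K i j)).val = Array.ofFn y₂ := by
      refine scatter_ofFn _ _ B (fun i => i) _ _ (by simpa using hB) ?_ ?_
      · intro i hi; simp [h₂, hi]
      · intro j hj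
        simp only [List.map_id'] at hj
        simp [h₂, hj]
    have e₃ : (callChild (l.integrate ε) (Array.ofFn x) (Array.ofFn y₂) (A.map Fin.val)
        (S.map Fin.val)).val = Array.ofFn y₃ := by
      refine callChild_val A S _ x (nodup_append_of_disjoint hA hS hsep.disjoint_AS) y₂ y₃ _
        (ihl _ hl _) ?_ ?_
      · intro k
        rw [torso_mulVec hsep, h₃]
        simp only
        rw [if_pos (Finset.orderEmbOfFin_mem _ rfl k)]
      · intro j hj
        rw [h₃]
        simp only
        rw [if_neg hj, add_zero]
    have e₄ : (callChild (r.integrate ε) (Array.ofFn x) (Array.ofFn y₃) (B.map Fin.val)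
        (S.map Fin.val)).val = Array.ofFn y₄ := by
      refine callChild_val B S _ x (nodup_append_of_disjoint hB hS hsep.disjoint_SB.symm) y₃ y₄ _
        (ihr _ hr _) ?_ ?_
      · intro k
        rw [torso_mulVec hsep.symm, h₄]
        simp only
        rw [if_pos (Finset.orderEmbOfFin_mem _ rfl k)]
      · intro j hj
        rw [h₄]
        simp only
        rw [if_neg hj, add_zero]
    have hsum : ∀ i, (G.kernel ε *ᵥ x) i = ∑ j ∈ A.toFinset, K i j + ∑ j ∈ S.toFinset, K i j +
        ∑ j ∈ B.toFinset, K i j := by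
      intro i
      rw [kernel_mulVec, ← hsep.cover, Finset.sum_union, Finset.sum_union hsep.disjoint_AS]
      rw [Finset.disjoint_union_left]
      exact ⟨hsep.disjoint_AB, hsep.disjoint_SB⟩
    -- Every block has been counted once, except `S × S`, which came from both children; the final
    -- `scatter` removes the surplus.
    have hval : ∀ i, y₄ i = (G.kernel ε *ᵥ x) i +
        if i ∈ S.toFinset then ∑ j ∈ S.toFinset, K i j else 0 := by
      intro i
      rw [hsum]
      simp only [h₄, h₃, h₂, h₁, Finset.sum_union hsep.disjoint_AS,
        Finset.sum_union hsep.disjoint_SB.symm, Finset.mem_union]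
      rcases hsep.mem_or i with hi | hi | hi
      · simp only [hi, hAS hi, hAB hi, if_true, if_false, or_false]
        simp; ring
      · have hiA : i ∉ A.toFinset := fun h => hAS h hi
        have hiB : i ∉ B.toFinset := fun h => hBS h hi
        simp only [hi, hiA, hiB, if_true, if_false, or_true]
        ring
      · have hiA : i ∉ A.toFinset := fun h => hAB h hi
        simp only [hi, hiA, hBS hi, if_true, if_false, or_false]
        simp; ring
    simp only [SGFI.integrate, crossCompute, val_bind, val_op, gather_ofFn, hz, len_val,
      List.length_map, crossHalf_separation hB hsep, crossHalf_separation hA hsep.symm]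
    rw [e₁, e₂, e₃, e₄, matVecF_map]
    refine scatter_ofFn _ _ S (fun i => i) _ _ (by simpa using hS) ?_ ?_
    · intro i hi
      rw [hval, if_pos (List.mem_toFinset.2 hi), ← sum_map_eq hS]
      ring
    · intro j hj
      simp only [List.map_id'] at hj
      rw [hval, if_neg (by simpa using hj), add_zero]

/-! ### Cost of a single node -/

namespace WGraph.IsSeparation

variable {n : ℕ} {G : WGraph n} {A S B : List (Fin n)}

theorem length_add (hA : A.Nodup) (hS : S.Nodup) (hB : B.Nodup)
    (hsep : G.IsSeparation A.toFinset S.toFinset B.toFinset) :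
    A.length + S.length + B.length = n := by
  rw [← List.toFinset_card_of_nodup hA, ← List.toFinset_card_of_nodup hS,
    ← List.toFinset_card_of_nodup hB, ← Finset.card_union_of_disjoint hsep.disjoint_AS,
    ← Finset.card_union_of_disjoint, hsep.cover, Finset.card_univ, Fintype.card_fin]
  rw [Finset.disjoint_union_left]
  exact ⟨hsep.disjoint_AB, hsep.disjoint_SB⟩

theorem card_union (hA : A.Nodup) (hS : S.Nodup)
    (hsep : G.IsSeparation A.toFinset S.toFinset B.toFinset) :
    (A.toFinset ∪ S.toFinset).card = A.length + S.length := by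
  rw [Finset.card_union_of_disjoint hsep.disjoint_AS, List.toFinset_card_of_nodup hA,
    List.toFinset_card_of_nodup hS]

end WGraph.IsSeparation

/-- The number of steps at an inner node, apart from the calls on the children. -/
theorem integrate_node_time {n : ℕ} {G : WGraph n} {A S B : List (Fin n)}
    (hA : A.Nodup) (hS : S.Nodup) (hB : B.Nodup)
    (hsep : G.IsSeparation A.toFinset S.toFinset B.toFinset) (l r : SGFI) (ε : ℝ)
    (x : Fin n → ℝ) (s L : ℕ) (hs : S.length ≤ s) (hn : 1 ≤ n) (hL : n ≤ 2 ^ L) :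
    ((SGFI.node (A.map Fin.val) (S.map Fin.val) (B.map Fin.val)
      (S.map fun i => S.map fun j => G.dist i j) (A.map fun i => S.map fun j => G.dist i j)
      (B.map fun i => S.map fun j => G.dist i j) l r).integrate ε (Array.ofFn x)).time ≤
      200 * (n * ((s + 1) ^ 2 * (L + 2) ^ (s + 1))) +
      (l.integrate ε (Array.ofFn fun k =>
        x ((A.toFinset ∪ S.toFinset).orderEmbOfFin rfl k))).time +
      (r.integrate ε (Array.ofFn fun k =>
        x ((B.toFinset ∪ S.toFinset).orderEmbOfFin rfl k))).time := by
  have hcard := hsep.length_add hA hS hB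
  have c1 := fun y => callChild_time A S (l.integrate ε) x
    (nodup_append_of_disjoint hA hS hsep.disjoint_AS) y L (by omega)
  have c2 := fun y => callChild_time B S (r.integrate ε) x
    (nodup_append_of_disjoint hB hS hsep.disjoint_SB.symm) y L (by omega)
  have c3 := crossHalf_time ε L S.length (A.map fun i => S.map fun j => G.dist i j)
    (B.map fun i => S.map fun j => G.dist i j) (B.map x) (by simp) (by simp)
    (by simp; omega) (by simp; omega)
  have c4 := crossHalf_time ε L S.length (B.map fun i => S.map fun j => G.dist i j)
    (A.map fun i => S.map fun j => G.dist i j) (A.map x) (by simp) (by simp)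
    (by simp; omega) (by simp; omega)
  have c5 := matVecF_time ε (S.map fun i => S.map fun j => G.dist i j) (S.map x)
  have c6 := fun y v => scatter_time (· + ·) y (A.map Fin.val) v
  have c7 := fun y v => scatter_time (· + ·) y (B.map Fin.val) v
  have c8 := fun y v => scatter_time (· - ·) y (S.map Fin.val) v
  simp only [List.length_map] at c3 c4 c5 c6 c7 c8
  simp only [SGFI.integrate, crossCompute, time_bind, val_bind, time_op, val_op, gather_ofFn,
    gather_time, len_val, len_time, List.length_map]
  have hz : (zeros (Array.ofFn x).size).time = n + 1 := by simp [zeros]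
  rw [hz]
  set t := S.length
  have hpow : 1 ≤ (L + 2) ^ s := Nat.one_le_pow _ _ (by omega)
  have hpt : (L + 2) ^ t ≤ (L + 2) ^ s := Nat.pow_le_pow_right (by omega) hs
  set N := n * ((s + 1) ^ 2 * (L + 2) ^ (s + 1)) with hN
  have q1 : n * ((s + 1) * (L + 2)) ≤ N := by
    rw [hN]
    refine Nat.mul_le_mul_left _ (Nat.mul_le_mul ?_ ?_)
    · exact Nat.le_self_pow (by norm_num) _
    · exact Nat.le_self_pow (by omega) _
  have hLn : (6 * L + 10) * n ≤ 10 * N := by nlinarith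
  have hnN : n ≤ N := by nlinarith
  have htn : t * t ≤ N := by
    have : t * t ≤ n * s := Nat.mul_le_mul (by omega) hs
    nlinarith
  -- The logarithmic factor from sorting raises the exponent of `L + 2` from `s` to `s + 1`; the
  -- loop over the separator and the factor `t + 1` give the square of `s + 1`.
  have hmain : t * ((6 * L + 16) * (t + 1) * (L + 2) ^ t * n) ≤ 16 * N := by
    calc t * ((6 * L + 16) * (t + 1) * (L + 2) ^ t * n)
        ≤ (s + 1) * ((16 * (L + 2)) * (s + 1) * (L + 2) ^ s * n) := by gcongr <;> omega
      _ = 16 * N := by rw [hN]; ring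
  have hab : t * ((6 * L + 16) * (t + 1) * (L + 2) ^ t * (A.length + B.length) + t + 4) ≤
      21 * N := by
    calc _ ≤ t * ((6 * L + 16) * (t + 1) * (L + 2) ^ t * n + t + 4) := by gcongr; omega
      _ = t * ((6 * L + 16) * (t + 1) * (L + 2) ^ t * n) + t * t + 4 * t := by ring
      _ ≤ 21 * N := by omega
  rw [add_comm B.length A.length] at c4
  have hA' : (6 * L + 10) * (A.length + t) ≤ 10 * N :=
    (Nat.mul_le_mul_left _ (by omega)).trans hLn
  have hB' : (6 * L + 10) * (B.length + t) ≤ 10 * N :=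
    (Nat.mul_le_mul_left _ (by omega)).trans hLn
  have hS' : (3 * t + 2) * t = 3 * (t * t) + 2 * t := by ring
  rw [hS'] at c5
  grw [c1, c2, c3, c4, c5, c6, c7, c8]
  omega

/-! ### Recursion over the tree -/

namespace SGFI

/-- Children never have more vertices than their parent. Used to replace `s` by `min s n`, which is
essential for `n < 4`, where powers of `log₂ n` cannot absorb `4 ^ s`. -/
theorem Represents.sepSizeLE {T : SGFI} {n : ℕ} {G : WGraph n} (hT : T.Represents G) {N : ℕ}
    (hN : n ≤ N) : T.SepSizeLE N := by
  induction T generalizing n with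
  | leaf W => trivial
  | node aIds sIds bIds SD AD BD l r ihl ihr =>
    obtain ⟨A, S, B, hA, hS, hB, hsep, rfl, rfl, rfl, -, -, -, hl, hr⟩ := hT
    have h1 := hsep.length_add hA hS hB
    have h2 := hsep.card_union hA hS
    have h3 := hsep.symm.card_union hB hS
    refine ⟨?_, ihl hl (by omega), ihr hr (by omega)⟩
    rw [List.length_map]
    omega

theorem SepSizeLE.min {T : SGFI} {s t : ℕ} (hs : T.SepSizeLE s) (ht : T.SepSizeLE t) :
    T.SepSizeLE (min s t) := by
  induction T with
  | leaf W => trivial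
  | node aIds sIds bIds SD AD BD l r ihl ihr =>
    exact ⟨le_min hs.1 ht.1, ihl hs.2.1 ht.2.1, ihr hs.2.2 ht.2.2⟩

/-- Allows the balance constant to be lowered to at most `1/2`, so that powers of `1 - c` are
nonnegative. -/
theorem Balanced.mono {T : SGFI} {c c' : ℝ} (h : c' ≤ c) (hT : T.Balanced c) :
    T.Balanced c' := by
  induction T with
  | leaf W => trivial
  | node aIds sIds bIds SD AD BD l r ihl ihr =>
    obtain ⟨h1, h2, h3, h4⟩ := hT
    have h0 := mul_le_mul_of_nonneg_right h
      (Nat.cast_nonneg (α := ℝ) (aIds.length + sIds.length + bIds.length))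
    exact ⟨h0.trans h1, h0.trans h2, ihl h3, ihr h4⟩

/-- The steps at a vertex of a graph, with separators of size at most `s`, leaves of size at most
`m`, and at most `2 ^ L` vertices. -/
def unitCost (s m L : ℕ) : ℕ := 200 * ((s + 1) ^ 2 * (L + 2) ^ (s + 1)) + 20 * m ^ 3

theorem leaf_time {W : List (List ℝ≥0∞)} {n : ℕ} {G : WGraph n} (hT : (leaf W).Represents G)
    {m : ℕ} (hm : (leaf W).LeafSizeLE m) (s L : ℕ) (ε : ℝ) (x : Fin n → ℝ) (hn : 1 ≤ n) :
    ((leaf W).integrate ε (Array.ofFn x)).time ≤ n * unitCost s m L := by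
  obtain rfl : W = G.adjRows := hT
  have hnm : n ≤ m := by simpa [LeafSizeLE, WGraph.adjRows] using hm
  calc _ ≤ 20 * n ^ 4 := bruteForce_time G ε x hn
    _ = n * (20 * n ^ 3) := by ring
    _ ≤ n * (20 * m ^ 3) := by gcongr
    _ ≤ _ := Nat.mul_le_mul_left _ (Nat.le_add_left _ _)

/-- The sizes of the children of a node, and the number of steps at the node. -/
theorem node_step {aIds sIds bIds : List ℕ} {SD AD BD : List (List ℝ≥0∞)} {l r : SGFI} {n : ℕ}
    {G : WGraph n} (hT : (node aIds sIds bIds SD AD BD l r).Represents G) {c : ℝ} (hc : 0 < c)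
    (hbal : (node aIds sIds bIds SD AD BD l r).Balanced c) {s : ℕ}
    (hs : (node aIds sIds bIds SD AD BD l r).SepSizeLE s) (hn : 1 ≤ n) (m : ℕ) {L : ℕ}
    (hL : n ≤ 2 ^ L) (ε : ℝ) (x : Fin n → ℝ) :
    ∃ (n₁ n₂ : ℕ) (G₁ : WGraph n₁) (G₂ : WGraph n₂) (x₁ : Fin n₁ → ℝ) (x₂ : Fin n₂ → ℝ),
      l.Represents G₁ ∧ r.Represents G₂ ∧ 2 ≤ n ∧ n₁ + n₂ ≤ n + s ∧ 1 ≤ n₁ ∧ 1 ≤ n₂ ∧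
      n₁ ≤ n ∧ n₂ ≤ n ∧ (n₁ : ℝ) ≤ n * (1 - c) ∧ (n₂ : ℝ) ≤ n * (1 - c) ∧
      c * n ≤ n₁ ∧ c * n ≤ n₂ ∧
      ((node aIds sIds bIds SD AD BD l r).integrate ε (Array.ofFn x)).time ≤
        n * unitCost s m L + (l.integrate ε (Array.ofFn x₁)).time +
          (r.integrate ε (Array.ofFn x₂)).time := by
  obtain ⟨A, S, B, hA, hS, hB, hsep, rfl, rfl, rfl, rfl, rfl, rfl, hl, hr⟩ := hT
  obtain ⟨b1, b2, -, -⟩ := hbal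
  obtain ⟨hs, -, -⟩ := hs
  have h1 := hsep.length_add hA hS hB
  have h2 := hsep.card_union hA hS
  have h3 := hsep.symm.card_union hB hS
  simp only [List.length_map, h1] at b1 b2 hs
  have hn' : (0 : ℝ) < n := by exact_mod_cast hn
  have hA0 : 0 < A.length := by
    have : (0 : ℝ) < A.length := (mul_pos hc hn').trans_le b1
    exact_mod_cast this
  have hB0 : 0 < B.length := by
    have : (0 : ℝ) < B.length := (mul_pos hc hn').trans_le b2
    exact_mod_cast this
  have h1' : (A.length : ℝ) + S.length + B.length = n := by exact_mod_cast h1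
  have h2' : ((A.toFinset ∪ S.toFinset).card : ℝ) = A.length + S.length := by exact_mod_cast h2
  have h3' : ((B.toFinset ∪ S.toFinset).card : ℝ) = B.length + S.length := by exact_mod_cast h3
  have hS0 : (0 : ℝ) ≤ S.length := Nat.cast_nonneg _
  have ht := integrate_node_time hA hS hB hsep l r ε x s L hs hn hL
  refine ⟨_, _, _, _, fun k => x ((A.toFinset ∪ S.toFinset).orderEmbOfFin rfl k),
    fun k => x ((B.toFinset ∪ S.toFinset).orderEmbOfFin rfl k), hl, hr, by omega, by omega, by omega, by omega, by omega, by omega,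
    by rw [h2']; linarith, by rw [h3']; linarith, by rw [h2']; linarith, by rw [h3']; linarith,
    ht.trans ?_⟩
  refine Nat.add_le_add_right (Nat.add_le_add_right ?_ _) _
  calc _ = n * (200 * ((s + 1) ^ 2 * (L + 2) ^ (s + 1))) := by ring
    _ ≤ _ := Nat.mul_le_mul_left _ (Nat.le_add_right _ _)

/-- The condition `n (1 - c)^h ≤ 1` says that `h` bounds the depth of the tree; it passes to a child
with `h` lowered by one. -/
theorem depth_step {c : ℝ} (hc' : c ≤ 1 / 2) {n n₁ h : ℕ} (h₁ : (n₁ : ℝ) ≤ n * (1 - c))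
    (hh : (n : ℝ) * (1 - c) ^ (h + 1) ≤ 1) : (n₁ : ℝ) * (1 - c) ^ h ≤ 1 := by
  refine le_trans ?_ hh
  calc (n₁ : ℝ) * (1 - c) ^ h ≤ n * (1 - c) * (1 - c) ^ h :=
        mul_le_mul_of_nonneg_right h₁ (pow_nonneg (by linarith) _)
    _ = n * (1 - c) ^ (h + 1) := by ring

/-- A bound that is exponential in the depth. -/
theorem time_le_four_pow (T : SGFI) {n : ℕ} {G : WGraph n} (hT : T.Represents G) {c : ℝ}
    (hc : 0 < c) (hc' : c ≤ 1 / 2) (hbal : T.Balanced c) {s m L : ℕ} (hs : T.SepSizeLE s)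
    (hm : T.LeafSizeLE m) (hn : 1 ≤ n) (hL : n ≤ 2 ^ L) (ε : ℝ) (x : Fin n → ℝ) (h : ℕ)
    (hh : (n : ℝ) * (1 - c) ^ h ≤ 1) :
    (T.integrate ε (Array.ofFn x)).time ≤ 4 ^ h * (n * unitCost s m L) := by
  induction T generalizing n h with
  | leaf W =>
    exact (leaf_time hT hm s L ε x hn).trans (Nat.le_mul_of_pos_left _ (by positivity))
  | node aIds sIds bIds SD AD BD l r ihl ihr =>
    obtain ⟨n₁, n₂, G₁, G₂, x₁, x₂, hl, hr, h2, -, p₁, p₂, le₁, le₂, c₁, c₂, -, -, ht⟩ :=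
      node_step hT hc hbal hs hn m hL ε x
    cases h with
    | zero =>
      -- An inner node has at least two vertices, since both `A` and `B` are nonempty, so the depth
      -- bound cannot be zero.
      rw [pow_zero, mul_one] at hh
      have : n ≤ 1 := by exact_mod_cast hh
      omega
    | succ h =>
      have t₁ := ihl hl hbal.2.2.1 hs.2.1 hm.1 p₁ (le₁.trans hL) x₁ h (depth_step hc' c₁ hh)
      have t₂ := ihr hr hbal.2.2.2 hs.2.2 hm.2 p₂ (le₂.trans hL) x₂ h (depth_step hc' c₂ hh)
      set Q := unitCost s m L
      -- The children are crudely given `n` vertices each; then `1 + 2 * 4 ^ h ≤ 4 ^ (h + 1)`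
      -- suffices.
      have u₁ : 4 ^ h * (n₁ * Q) ≤ 4 ^ h * (n * Q) := by gcongr
      have u₂ : 4 ^ h * (n₂ * Q) ≤ 4 ^ h * (n * Q) := by gcongr
      have u₃ : n * Q ≤ 4 ^ h * (n * Q) := Nat.le_mul_of_pos_left _ (by positivity)
      have u₄ : 4 ^ (h + 1) * (n * Q) = 4 * (4 ^ h * (n * Q)) := by ring
      omega

/-- Since `s ≤ n / 2`, the potential `n - s` is at least `n / 2`, and the factor `2` in front of `Q`
converts the crude bound into one in terms of the potential. -/
theorem add_le_of_le_four_pow {n s Q h h₀ t : ℕ} (hns : 2 * s ≤ n) (ht : t ≤ 4 ^ h₀ * (n * Q)) :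
    t + s * (2 * Q * (h + 4 ^ h₀)) ≤ n * (2 * Q * (h + 4 ^ h₀)) := by
  have h1 : 2 * s * (Q * (h + 4 ^ h₀)) ≤ n * (Q * (h + 4 ^ h₀)) := Nat.mul_le_mul_right _ hns
  calc _ ≤ 4 ^ h₀ * (n * Q) + 2 * s * (Q * (h + 4 ^ h₀)) :=
        add_le_add ht (le_of_eq (by ring))
    _ ≤ 4 ^ h₀ * (n * Q) + n * (Q * (h + 4 ^ h₀)) := by gcongr
    _ ≤ n * Q * h + 4 ^ h₀ * (n * Q) + n * (Q * (h + 4 ^ h₀)) := by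
      gcongr; exact Nat.le_add_left _ _
    _ = _ := by ring

/-- A bound that is linear in the depth, for graphs that are large compared with the separators.
Small subgraphs have depth at most `h₀`. -/
theorem time_add_le (T : SGFI) {n : ℕ} {G : WGraph n} (hT : T.Represents G) {c : ℝ}
    (hc : 0 < c) (hc' : c ≤ 1 / 2) (hbal : T.Balanced c) {s m L : ℕ} (hs : T.SepSizeLE s)
    (hm : T.LeafSizeLE m) (hn : 1 ≤ n) (hL : n ≤ 2 ^ L) (ε : ℝ) (x : Fin n → ℝ) (h : ℕ)
    (hh : (n : ℝ) * (1 - c) ^ h ≤ 1) {D h₀ : ℕ} (hD : 2 ≤ c * D)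
    (hh₀ : ((D * s : ℕ) : ℝ) * (1 - c) ^ h₀ ≤ 1) (hns : 2 * s ≤ n) :
    (T.integrate ε (Array.ofFn x)).time + s * (2 * unitCost s m L * (h + 4 ^ h₀)) ≤
      n * (2 * unitCost s m L * (h + 4 ^ h₀)) := by
  induction T generalizing n h with
  | leaf W =>
    exact add_le_of_le_four_pow hns ((leaf_time hT hm s L ε x hn).trans
      (Nat.le_mul_of_pos_left _ (by positivity)))
  | node aIds sIds bIds SD AD BD l r ihl ihr =>
    rcases le_or_gt n (D * s) with hle | hlt
    · refine add_le_of_le_four_pow hns (time_le_four_pow _ hT hc hc' hbal hs hm hn hL ε x h₀ (le_trans ?_ hh₀))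
      exact mul_le_mul_of_nonneg_right (by exact_mod_cast hle) (pow_nonneg (by linarith) _)
    obtain ⟨n₁, n₂, G₁, G₂, x₁, x₂, hl, hr, h2, hsum, p₁, p₂, le₁, le₂, c₁, c₂, d₁, d₂, ht⟩ :=
      node_step hT hc hbal hs hn m hL ε x
    -- This is the purpose of `D`: above `D * s` vertices each child still has at least `2 * s`, so
    -- the induction hypothesis applies to both.
    have hcn : (2 : ℝ) * s ≤ c * n := by
      have : ((D * s : ℕ) : ℝ) ≤ n := by exact_mod_cast hlt.le
      push_cast at this
      calc (2 : ℝ) * s ≤ c * D * s := by gcongr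
        _ = c * (D * s) := by ring
        _ ≤ c * n := by gcongr
    have g₁ : 2 * s ≤ n₁ := by exact_mod_cast hcn.trans d₁
    have g₂ : 2 * s ≤ n₂ := by exact_mod_cast hcn.trans d₂
    cases h with
    | zero =>
      rw [pow_zero, mul_one] at hh
      have : n ≤ 1 := by exact_mod_cast hh
      omega
    | succ h =>
      have t₁ := ihl hl hbal.2.2.1 hs.2.1 hm.1 p₁ (le₁.trans hL) x₁ h (depth_step hc' c₁ hh) g₁
      have t₂ := ihr hr hbal.2.2.2 hs.2.2 hm.2 p₂ (le₂.trans hL) x₂ h (depth_step hc' c₂ hh) g₂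
      set Q := unitCost s m L
      set E := 2 * Q * (h + 4 ^ h₀) with hE
      have e : 2 * Q * (h + 1 + 4 ^ h₀) = E + 2 * Q := by rw [hE]; ring
      -- The total potential of the children, `n₁ + n₂ - 2s`, is at most `n - s`; raising the depth
      -- by one adds `2Q (n - s) ≥ nQ`, which pays for the node.
      have e₁ : n₁ * E + n₂ * E ≤ n * E + s * E := by
        rw [← add_mul, ← add_mul]; exact Nat.mul_le_mul_right _ hsum
      have e₂ : 2 * s * Q ≤ n * Q := Nat.mul_le_mul_right _ hns
      have e₃ : s * (2 * Q) = 2 * s * Q := by ring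
      have e₄ : n * (2 * Q) = 2 * (n * Q) := by ring
      rw [e, mul_add, mul_add, e₃, e₄]
      omega

/-- The total number of steps for a graph with `n` vertices. -/
theorem time_le (T : SGFI) {n : ℕ} {G : WGraph n} (hT : T.Represents G) {c : ℝ}
    (hc : 0 < c) (hc' : c ≤ 1 / 2) (hbal : T.Balanced c) {s m : ℕ} (hs : T.SepSizeLE s)
    (hm : T.LeafSizeLE m) (hn : 1 ≤ n) (ε : ℝ) (x : Fin n → ℝ) {κ D : ℕ}
    (hκ : (1 - c) ^ κ ≤ 1 / 2) (hD : 2 ≤ c * D) :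
    (T.integrate ε (Array.ofFn x)).time ≤ n * (2 * unitCost s m (Nat.clog 2 n) *
      (κ * Nat.clog 2 n + (2 * D * s + 1) ^ (2 * κ))) := by
  -- By the choice of `κ`, every `κ` levels at least halve the size.
  have hdepth : ∀ k : ℕ, (k : ℝ) * (1 - c) ^ (κ * Nat.clog 2 k) ≤ 1 := by
    intro k
    have h1 : (k : ℝ) ≤ 2 ^ Nat.clog 2 k := by exact_mod_cast Nat.le_pow_clog one_lt_two k
    have h2 : (1 - c) ^ (κ * Nat.clog 2 k) ≤ (1 / 2) ^ Nat.clog 2 k := by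
      rw [pow_mul]
      exact pow_le_pow_left₀ (pow_nonneg (by linarith) _) hκ _
    calc (k : ℝ) * (1 - c) ^ (κ * Nat.clog 2 k) ≤ 2 ^ Nat.clog 2 k * (1 / 2) ^ Nat.clog 2 k :=
          mul_le_mul h1 h2 (pow_nonneg (by linarith) _) (by positivity)
      _ = 1 := by rw [← mul_pow]; norm_num
  -- The least power of two that is at least `D * s` is at most `2 * D * s + 1`; the summand `1`
  -- covers `s = 0`.
  have hfour : 4 ^ (κ * Nat.clog 2 (D * s)) ≤ (2 * D * s + 1) ^ (2 * κ) := by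
    have h1 : 2 ^ Nat.clog 2 (D * s) ≤ 2 * D * s + 1 := by
      rcases Nat.lt_or_ge 1 (D * s) with h | h
      · have h2 := Nat.pow_pred_clog_lt_self one_lt_two h
        have h3 := Nat.clog_pos one_lt_two h
        obtain ⟨j, hj⟩ := Nat.exists_eq_succ_of_ne_zero h3.ne'
        rw [hj, Nat.pred_succ] at h2
        rw [hj, pow_succ, mul_assoc 2 D s]
        omega
      · rw [Nat.clog_of_right_le_one h, pow_zero]
        omega
    calc 4 ^ (κ * Nat.clog 2 (D * s)) = (2 ^ Nat.clog 2 (D * s)) ^ (2 * κ) := by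
          rw [show 4 = 2 ^ 2 by norm_num, ← pow_mul, ← pow_mul]
          congr 1
          ring
      _ ≤ _ := Nat.pow_le_pow_left h1 _
  have hL := Nat.le_pow_clog one_lt_two n
  set Q := unitCost s m (Nat.clog 2 n)
  set h := κ * Nat.clog 2 n
  set h₀ := κ * Nat.clog 2 (D * s)
  refine le_trans ?_ (Nat.mul_le_mul_left n (Nat.mul_le_mul_left (2 * Q)
    (Nat.add_le_add_left hfour h)))
  rcases le_or_gt n (D * s) with hle | hlt
  · have h1 := time_le_four_pow T hT hc hc' hbal hs hm hn hL ε x h₀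
      (le_trans (mul_le_mul_of_nonneg_right (by exact_mod_cast hle) (pow_nonneg (by linarith) _))
        (hdepth (D * s)))
    calc _ ≤ 4 ^ h₀ * (n * Q) := h1
      _ ≤ 4 ^ h₀ * (n * Q) + (4 ^ h₀ * (n * Q) + n * (2 * Q * h)) := Nat.le_add_right _ _
      _ = _ := by ring
  · have hD2 : 2 ≤ D := by
      have : (2 : ℝ) ≤ D := by nlinarith [Nat.cast_nonneg (α := ℝ) D]
      exact_mod_cast this
    have hns : 2 * s ≤ n := (Nat.mul_le_mul_right s hD2).trans hlt.le
    exact (Nat.le_add_right _ _).trans (time_add_le T hT hc hc' hbal hs hm hn hL ε x h (hdepth n)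
      hD (hdepth (D * s)) hns)

end SGFI

/-! ### From `Nat.clog` to powers of `log₂ n`, and the final constants -/

/-- The powers of the logarithm that occur, for separators with at most `min s n` vertices. -/
theorem clog_pow_le {n : ℕ} (hn : 2 ≤ n) (s : ℕ) :
    ((Nat.clog 2 n + 2 : ℕ) : ℝ) ^ (min s n + 1) ≤ 256 * Real.logb 2 n ^ (3 * s + 4) ∧
      (Nat.clog 2 n : ℝ) ≤ 2 * Real.logb 2 n ∧ 1 ≤ Real.logb 2 n := by
  set a := Real.logb 2 n with ha
  have hn0 : (0 : ℝ) < n := by positivity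
  have h1 : 1 ≤ a := by
    rw [ha, Real.le_logb_iff_rpow_le one_lt_two hn0]
    simpa using (by exact_mod_cast hn : (2 : ℝ) ≤ n)
  have h2 : (Nat.clog 2 n : ℝ) ≤ a + 1 := by
    have h3 := Nat.pow_pred_clog_lt_self one_lt_two (show 1 < n by omega)
    have h4 : ((Nat.clog 2 n).pred : ℝ) ≤ a := by
      rw [ha, Real.le_logb_iff_rpow_le one_lt_two hn0, Real.rpow_natCast]
      exact_mod_cast h3.le
    have h5 : (Nat.clog 2 n : ℝ) ≤ (Nat.clog 2 n).pred + 1 := by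
      exact_mod_cast (by rw [Nat.pred_eq_sub_one]; omega :
        Nat.clog 2 n ≤ (Nat.clog 2 n).pred + 1)
    linarith
  have h6 : ((Nat.clog 2 n + 2 : ℕ) : ℝ) ≤ 4 * a := by push_cast; linarith
  refine ⟨?_, by linarith, h1⟩
  have h7 : ((Nat.clog 2 n + 2 : ℕ) : ℝ) ^ (min s n + 1) ≤ (4 * a) ^ (min s n + 1) :=
    pow_le_pow_left₀ (Nat.cast_nonneg _) h6 _
  refine h7.trans ?_
  -- For `n < 4` the logarithm may be `1`, but `min s n + 1 ≤ 4`, so the constant is at most `4 ^ 4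
  -- = 256`. For `n ≥ 4` it is at least `2`, and `4a ≤ a ^ 3` absorbs the constant at the price of
  -- tripling the exponent.
  rcases Nat.lt_or_ge n 4 with h | h
  · calc (4 * a) ^ (min s n + 1) ≤ (4 * a) ^ 4 :=
          pow_le_pow_right₀ (by linarith) (by omega)
      _ = 256 * a ^ 4 := by ring
      _ ≤ 256 * a ^ (3 * s + 4) := by
        gcongr
        · omega
  · have h8 : 2 ≤ a := by
      rw [ha, Real.le_logb_iff_rpow_le one_lt_two hn0]
      have : (4 : ℝ) ≤ n := by exact_mod_cast h
      norm_num
      linarith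
    have h9 : 4 * a ≤ a ^ 3 := by
      rw [pow_succ]
      exact mul_le_mul_of_nonneg_right (by nlinarith) (by linarith)
    calc (4 * a) ^ (min s n + 1) ≤ (a ^ 3) ^ (min s n + 1) :=
          pow_le_pow_left₀ (by linarith) h9 _
      _ = a ^ (3 * (min s n + 1)) := by rw [pow_mul]
      _ ≤ a ^ (3 * s + 4) := pow_le_pow_right₀ h1 (by omega)
      _ ≤ 256 * a ^ (3 * s + 4) := by
        have : 0 ≤ a ^ (3 * s + 4) := by positivity
        linarith

theorem integrate_time (c : ℝ) (hc : 0 < c) (leafSize : Polynomial ℕ) :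
    ∃ (C : ℕ) (poly : Polynomial ℕ), ∀ (n : ℕ) (G : WGraph n) (T : SGFI) (s : ℕ), 2 ≤ n →
      T.Represents G → T.Balanced c → T.SepSizeLE s → T.LeafSizeLE (leafSize.eval s) →
      ∀ ε : ℝ, 0 < ε → ∀ x : Fin n → ℝ, ((T.integrate ε (Array.ofFn x)).time : ℝ) ≤
        C * (n * poly.eval s * Real.logb 2 n ^ poly.eval s) := by
  set c' := min c (1 / 2) with hc'
  have hc0 : 0 < c' := lt_min hc (by norm_num)
  have hc2 : c' ≤ 1 / 2 := min_le_right _ _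
  obtain ⟨κ, hκ⟩ := exists_pow_lt_of_lt_one (show (0 : ℝ) < 1 / 2 by norm_num)
    (show 1 - c' < 1 by linarith)
  obtain ⟨D, hD⟩ := exists_nat_ge (2 / c')
  rw [div_le_iff₀ hc0, mul_comm] at hD
  -- Here `51200 = 200 * 256` combines the constants of `unitCost` and `clog_pow_le`. The exponent
  -- `3s + 5` of `E` is `3s + 4` from that lemma plus one logarithm for the depth. The sum `P + E`
  -- serves both as coefficient and as exponent, since `log₂ n ≥ 1`.
  set P : Polynomial ℕ := 2 * (51200 * (Polynomial.X + 1) ^ 2 + 20 * leafSize ^ 3) *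
    (Polynomial.C (2 * κ) + (Polynomial.C (2 * D) * Polynomial.X + 1) ^ (2 * κ)) with hP
  set E : Polynomial ℕ := 3 * Polynomial.X + 5 with hE
  refine ⟨1, P + E, ?_⟩
  intro n G T s hn hT hbal hs hm ε _ x
  have hPs : P.eval s = 2 * (51200 * (s + 1) ^ 2 + 20 * leafSize.eval s ^ 3) *
      (2 * κ + (2 * D * s + 1) ^ (2 * κ)) := by simp [hP]
  have hEs : E.eval s = 3 * s + 5 := by simp [hE]
  have ht := SGFI.time_le T hT hc0 hc2 (hbal.mono (min_le_left _ _))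
    (hs.min (hT.sepSizeLE le_rfl)) hm (by omega) ε x hκ.le hD
  obtain ⟨h1, h2, h3⟩ := clog_pow_le hn s
  set a := Real.logb 2 n
  have ha : 1 ≤ a ^ (3 * s + 4) := one_le_pow₀ h3
  set L := Nat.clog 2 n
  set m := leafSize.eval s
  set W := (2 * D * s + 1) ^ (2 * κ) with hW
  have hQ : (SGFI.unitCost (min s n) m L : ℝ) ≤
      (51200 * ((s : ℝ) + 1) ^ 2 + 20 * (m : ℝ) ^ 3) * a ^ (3 * s + 4) := by
    rw [SGFI.unitCost, Nat.cast_add, Nat.cast_mul, Nat.cast_mul, Nat.cast_mul, Nat.cast_pow,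
      Nat.cast_pow, Nat.cast_pow, add_mul]
    refine add_le_add ?_ ?_
    · calc ((200 : ℕ) : ℝ) * (((min s n + 1 : ℕ) : ℝ) ^ 2 * ((L + 2 : ℕ) : ℝ) ^ (min s n + 1))
          ≤ (200 : ℕ) * (((s : ℝ) + 1) ^ 2 * (256 * a ^ (3 * s + 4))) := by
            gcongr
            push_cast
            gcongr
            exact min_le_left _ _
        _ = _ := by push_cast; ring
    · push_cast
      exact le_mul_of_one_le_right (by positivity) ha
  have hR : ((κ * L + (2 * D * min s n + 1) ^ (2 * κ) : ℕ) : ℝ) ≤ (2 * κ + W : ℕ) * a := by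
    have hWW : (((2 * D * min s n + 1) ^ (2 * κ) : ℕ) : ℝ) ≤ W := by
      rw [hW]
      exact_mod_cast Nat.pow_le_pow_left
        (Nat.add_le_add_right (Nat.mul_le_mul_left _ (min_le_left s n)) 1) _
    rw [Nat.cast_add, Nat.cast_add, add_mul]
    refine add_le_add ?_ (hWW.trans (le_mul_of_one_le_right (Nat.cast_nonneg _) h3))
    push_cast
    calc (κ : ℝ) * L ≤ κ * (2 * a) := by gcongr
      _ = _ := by ring
  have ht' : ((T.integrate ε (Array.ofFn x)).time : ℝ) ≤ n * (P.eval s * a ^ E.eval s) := by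
    calc ((T.integrate ε (Array.ofFn x)).time : ℝ)
        ≤ n * (2 * SGFI.unitCost (min s n) m L *
          (κ * L + (2 * D * min s n + 1) ^ (2 * κ) : ℕ)) := by exact_mod_cast ht
      _ ≤ n * (2 * ((51200 * ((s : ℝ) + 1) ^ 2 + 20 * (m : ℝ) ^ 3) * a ^ (3 * s + 4)) *
          ((2 * κ + W : ℕ) * a)) := by gcongr
      _ = _ := by
        rw [hPs, hEs]
        push_cast
        ring
  rw [Nat.cast_one, one_mul, Polynomial.eval_add, mul_assoc]
  refine ht'.trans (mul_le_mul_of_nonneg_left (mul_le_mul ?_ ?_ (by positivity) (by positivity))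
    (Nat.cast_nonneg _))
  · exact_mod_cast Nat.le_add_right _ _
  · exact pow_le_pow_right₀ h3 (Nat.le_add_left _ _)

end GraphField

end

theorem mainTheorem1 :
    (∀ (n : ℕ) (G : GraphField.WGraph n) (T : GraphField.SGFI), T.Represents G →
      ∀ ε : ℝ, 0 < ε → ∀ x : Fin n → ℝ,
        (T.integrate ε (Array.ofFn x)).val = Array.ofFn (G.kernel ε *ᵥ x)) ∧
    (∀ c : ℝ, 0 < c → ∀ leafSize : Polynomial ℕ, ∃ (C : ℕ) (poly : Polynomial ℕ),
      ∀ (n : ℕ) (G : GraphField.WGraph n) (T : GraphField.SGFI) (s : ℕ), 2 ≤ n →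
        T.Represents G → T.Balanced c → T.SepSizeLE s → T.LeafSizeLE (leafSize.eval s) →
        ∀ ε : ℝ, 0 < ε → ∀ x : Fin n → ℝ,
          ((T.integrate ε (Array.ofFn x)).time : ℝ) ≤
            C * (n * poly.eval s * Real.logb 2 n ^ poly.eval s)) := by
  exact ⟨fun n G T hT ε _ x => GraphField.integrate_val T G hT ε x,
    fun c hc leafSize => GraphField.integrate_time c hc leafSize⟩
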